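/- Let $\mathscr{B}$ be the category of based (compactly generated weak Hausdorff) spaces with the smash product $\wedge$. A \emph{$1$-operad} in $\mathscr{B}$ consists of based spaces $\mathscr{C}(n)$, $n=1,2,\dots$, with a right action of the symmetric group $\Sigma_n$ on $\mathscr{C}(n)$ by based maps, a unit $S^0\to\mathscr{C}(1)$, and based maps $$\gamma:\mathscr{C}(k)\wedge\mathscr{C}(n_1)\wedge\dots\wedge\mathscr{C}(n_k)\to\mathscr{C}(n_1+\dots+n_k),$$ satisfying the usual associativity, unit and equivariance axioms. A morphism of $1$-operads is a sequence of based maps preserving this structure; it is called an \emph{equivalence} if each of its terms is a weak homotopy equivalence. Two $1$-operads are called \emph{equivalent} ($\sim$) if they are connected by a finite zigzag of equivalences of $1$-operads. Consider the following two $1$-operads in $\mathscr{B}$; a quotient $X/B$ has the class of $B$ as its base point, and $X/\emptyset$ is $X$ with a disjoint base point added. (a) $Q(n)=\overline{A}_n/\overline{B}_n$, where $$\overline{A}_n=\{(J_1,\dots,J_n)\mid J_i=[s_i,t_i],\ 0\le s_i<t_i\le 1\}\subset\mathbb{R}^{2n},$$ $$\overline{B}_n=\{(J_1,\dots,J_n)\in\overline{A}_n\mid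 \mathrm{Interior}(J_1\cap\dots\cap J_n)=\emptyset\}.$$ The group $\Sigma_n$ permutes the intervals, the unit is $[0,1]$, and the composition of $(J_1,\dots,J_k)$ with $(K_{i,1},\dots,K_{i,n_i})$, $1\le i\le k$, is the tuple (ordered lexicographically) of the intervals $\ell_{J_i}(K_{i,j})$, where $\ell_J:[0,1]\to J$ is the increasing linear homeomorphism. (b) $\mathscr{J}(n)=\Delta^{n-1}/\partial\Delta^{n-1}$ (the Arone--Kankaanrinta operad), where $\Delta^{n-1}$ is the standard simplex with barycentric coordinates $[t_1,\dots,t_n]$. The group $\Sigma_n$ permutes the coordinates, the unit is the point $[1]$ of $\Delta^0$, and the composition of $[s_1,\dots,s_k]$ with $[t_{i,1},\dots,t_{i,n_i}]$, $1\le i\le k$, is $$[s_1t_{1,1},\dots,s_1t_{1,n_1},\dots,s_kt_{k,1},\dots,s_kt_{k,n_k}].$$ Then $Q$ and $\mathscr{J}$ are equivalent as $1$-operads in $\mathscr{B}$: $\ Q\sim\mathscr{J}$. -/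

import Mathlib

open scoped Topology

/-! ### Based spaces, smash products and weak equivalences -/

/-- A based space: a compactly generated weak Hausdorff space with a chosen point. -/
structure BasedSpace : Type 1 where
  carrier : Type
  [top : TopologicalSpace carrier]
  [compactlyGenerated : CompactlyGeneratedSpace carrier]
  weakHausdorff : ∀ (K : Type) [TopologicalSpace K] [CompactSpace K] [T2Space K]
    (f : K → carrier), Continuous f → IsClosed (Set.range f)
  pt : carrier

namespace BasedSpace

instance : CoeSort BasedSpace Type := ⟨carrier⟩

instance (X : BasedSpace) : TopologicalSpace X := X.top

instance (X : BasedSpace) : CompactlyGeneratedSpace X := X.compactlyGenerated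

/-- The product of a family of based spaces, as a set. -/
def KProd {ι : Type} (X : ι → BasedSpace) : Type := ∀ i, X i

/-- The product in compactly generated spaces: the compactly generated topology associated with
the product topology. -/
instance {ι : Type} (X : ι → BasedSpace) : TopologicalSpace (KProd X) :=
  @TopologicalSpace.compactlyGenerated.{0} (∀ i, X i) Pi.topologicalSpace

/-- The relation that identifies to one point all tuples with some coordinate at the base point. -/
def smashSetoid {ι : Type} (X : ι → BasedSpace) : Setoid (KProd X) where
  r x y := x = y ∨ ((∃ i, x i = (X i).pt) ∧ ∃ i, y i = (X i).pt)
  iseqv :=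
    { refl := fun _ => Or.inl rfl
      symm := by
        rintro x y (h | h)
        · exact Or.inl h.symm
        · exact Or.inr h.symm
      trans := by
        rintro x y z (rfl | h) (rfl | h')
        · exact Or.inl rfl
        · exact Or.inr h'
        · exact Or.inr h
        · exact Or.inr ⟨h.1, h'.2⟩ }

/-- The smash product of a (non-empty) family of based spaces, with the quotient topology. -/
def Smash {ι : Type} (X : ι → BasedSpace) : Type := Quotient (smashSetoid X)

instance {ι : Type} (X : ι → BasedSpace) : TopologicalSpace (Smash X) :=
  inferInstanceAs (TopologicalSpace (Quotient (smashSetoid X)))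

/-- The class of a tuple in the smash product. -/
def Smash.mk {ι : Type} (X : ι → BasedSpace) (x : ∀ i, X i) : Smash X :=
  Quotient.mk (smashSetoid X) x

/-- The base point of the smash product. -/
def Smash.pt {ι : Type} (X : ι → BasedSpace) : Smash X := Smash.mk X fun i => (X i).pt

end BasedSpace

/-- The map induced on the `n`-th homotopy group (on the set of path components if `n = 0`). -/
def homotopyGroupMap {X Y : Type} [TopologicalSpace X] [TopologicalSpace Y] (f : C(X, Y))
    (n : ℕ) (x : X) : HomotopyGroup.Pi n X x → HomotopyGroup.Pi n Y (f x) :=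
  Quotient.map
    (fun p : GenLoop (Fin n) X x =>
      (⟨f.comp p.1, fun y hy => congrArg f (p.2 y hy)⟩ : GenLoop (Fin n) Y (f x)))
    (fun _ _ h => h.map fun H => H.compContinuousMap f)

/-- Weak homotopy equivalences: bijections on path components and on all homotopy groups, for all
choices of base points. -/
def IsWeakHomotopyEquiv {X Y : Type} [TopologicalSpace X] [TopologicalSpace Y]
    (f : C(X, Y)) : Prop :=
  ∀ (n : ℕ) (x : X), Function.Bijective (homotopyGroupMap f n x)

/-! ### 1-operads in based spaces -/

/-- The sum `n₁ + ⋯ + n_k` of positive integers, with `k ≥ 1`. -/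
def total {k : ℕ+} (n : Fin k → ℕ+) : ℕ+ :=
  ⟨∑ s, (n s : ℕ), Finset.sum_pos (fun s _ => (n s).pos)
    ⟨⟨0, k.pos⟩, Finset.mem_univ _⟩⟩

/-- The `k` consecutive blocks of lengths `n₁, …, n_k`: the pair `(s, r)` is sent to the place of
the `r`-th letter of the `s`-th block in the concatenation of the blocks. -/
def blockEquiv {k : ℕ+} (n : Fin k → ℕ+) : (s : Fin k) × Fin (n s) ≃ Fin (total n) :=
  finSigmaFinEquiv

theorem total_comp_perm {k : ℕ+} (n : Fin k → ℕ+) (σ : Equiv.Perm (Fin k)) :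
    total (fun s => n (σ s)) = total n :=
  PNat.eq (Equiv.sum_comp σ fun s => (n s : ℕ))

/-- The block permutation `σ(n₁, …, n_k)`: it moves the `s`-th block, of length `n (σ s)`, onto
the `σ s`-th block, preserving the order inside the block. -/
def blockPerm {k : ℕ+} (n : Fin k → ℕ+) (σ : Equiv.Perm (Fin k)) :
    Equiv.Perm (Fin (total n)) :=
  (finCongr (congrArg PNat.val (total_comp_perm n σ).symm)).trans <|
    (blockEquiv fun s => n (σ s)).symm.trans <|
      (Equiv.sigmaCongrLeft (β := fun s => Fin (n s)) σ).trans (blockEquiv n)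

/-- The permutation `τ₁ ⊕ ⋯ ⊕ τ_k`. -/
def sumPerm {k : ℕ+} (n : Fin k → ℕ+) (τ : ∀ s, Equiv.Perm (Fin (n s))) :
    Equiv.Perm (Fin (total n)) :=
  (blockEquiv n).symm.trans ((Equiv.sigmaCongrRight τ).trans (blockEquiv n))

theorem total_const_one (n : ℕ+) : total (fun _ : Fin (1 : ℕ+) => n) = n :=
  PNat.eq (Fin.sum_univ_one fun _ => (n : ℕ))

theorem total_one_const (k : ℕ+) : total (fun _ : Fin k => (1 : ℕ+)) = k :=
  PNat.eq (by simp [total])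

theorem total_total {k : ℕ+} (n : Fin k → ℕ+) (i : Fin (total n) → ℕ+) :
    total (fun s => total fun q => i (blockEquiv n ⟨s, q⟩)) = total i := by
  apply PNat.eq
  change ∑ s, ∑ q, (i (blockEquiv n ⟨s, q⟩) : ℕ) = ∑ t, (i t : ℕ)
  rw [← (blockEquiv n).sum_comp, Fintype.sum_sigma]

/-- The family `C(k), C(n₁), …, C(n_k)`. -/
def compFamily (C : ℕ+ → BasedSpace) {k : ℕ+} (n : Fin k → ℕ+) :
    Option (Fin k) → BasedSpace
  | none => C k
  | some s => C (n s)

/-- The tuple `(c, d₁, …, d_k)`. -/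
def compTuple {C : ℕ+ → BasedSpace} {k : ℕ+} {n : Fin k → ℕ+} (c : C k) (d : ∀ s, C (n s)) :
    ∀ j, compFamily C n j
  | none => c
  | some s => d s

/-- Transport along an equality of arities. -/
def arityCast (C : ℕ+ → BasedSpace) {m n : ℕ+} (h : m = n) (x : C m) : C n := h ▸ x

/-- The structure maps of a 1-operad: spaces `C(n)` for `n ≥ 1`, a right action of the symmetric
group on each `C(n)`, a unit (a based map `S⁰ → C(1)`, that is, a point of `C(1)`), and
composition maps `C(k) ∧ C(n₁) ∧ ⋯ ∧ C(n_k) → C(n₁ + ⋯ + n_k)`. -/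
structure OneOperadData : Type 1 where
  obj : ℕ+ → BasedSpace
  act : ∀ {n : ℕ+}, obj n → Equiv.Perm (Fin n) → obj n
  unit : obj 1
  comp : ∀ {k : ℕ+} (n : Fin k → ℕ+), BasedSpace.Smash (compFamily obj n) → obj (total n)

/-- The composition `γ(c; d₁, …, d_k)`. -/
def OneOperadData.γ (C : OneOperadData) {k : ℕ+} {n : Fin k → ℕ+} (c : C.obj k)
    (d : ∀ s, C.obj (n s)) : C.obj (total n) :=
  C.comp n (BasedSpace.Smash.mk (compFamily C.obj n) (compTuple c d))

/-- A 1-operad in based spaces: the structure maps are morphisms of based spaces, and the usual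
associativity, unit and equivariance axioms hold. -/
structure OneOperad : Type 1 extends OneOperadData where
  continuous_act : ∀ {n : ℕ+} (σ : Equiv.Perm (Fin n)),
    Continuous fun x : obj n => act x σ
  act_pt : ∀ {n : ℕ+} (σ : Equiv.Perm (Fin n)), act (obj n).pt σ = (obj n).pt
  act_one : ∀ {n : ℕ+} (x : obj n), act x 1 = x
  act_mul : ∀ {n : ℕ+} (x : obj n) (σ τ : Equiv.Perm (Fin n)),
    act x (σ * τ) = act (act x σ) τ
  continuous_comp : ∀ {k : ℕ+} (n : Fin k → ℕ+), Continuous (comp n)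
  comp_pt : ∀ {k : ℕ+} (n : Fin k → ℕ+),
    comp n (BasedSpace.Smash.pt (compFamily obj n)) = (obj (total n)).pt
  assoc : ∀ {k : ℕ+} {n : Fin k → ℕ+} {i : Fin (total n) → ℕ+}
    (c : obj k) (d : ∀ s, obj (n s)) (e : ∀ t, obj (i t)),
    toOneOperadData.γ (toOneOperadData.γ c d) e =
      arityCast obj (total_total n i)
        (toOneOperadData.γ c fun s => toOneOperadData.γ (d s) fun q => e (blockEquiv n ⟨s, q⟩))
  unit_left : ∀ {n : ℕ+} (d : obj n),
    arityCast obj (total_const_one n) (toOneOperadData.γ unit fun _ => d) = d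
  unit_right : ∀ {k : ℕ+} (c : obj k),
    arityCast obj (total_one_const k) (toOneOperadData.γ c fun _ => unit) = c
  equivariant_outer : ∀ {k : ℕ+} {n : Fin k → ℕ+} (c : obj k) (d : ∀ s, obj (n s))
    (σ : Equiv.Perm (Fin k)),
    arityCast obj (total_comp_perm n σ) (toOneOperadData.γ (act c σ) fun s => d (σ s)) =
      act (toOneOperadData.γ c d) (blockPerm n σ)
  equivariant_inner : ∀ {k : ℕ+} {n : Fin k → ℕ+} (c : obj k) (d : ∀ s, obj (n s))
    (τ : ∀ s, Equiv.Perm (Fin (n s))),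
    toOneOperadData.γ c (fun s => act (d s) (τ s)) =
      act (toOneOperadData.γ c d) (sumPerm n τ)

/-- A morphism of 1-operads: based maps that preserve the operations. -/
structure OneOperadHom (C D : OneOperad) where
  map : ∀ n : ℕ+, C(C.obj n, D.obj n)
  map_pt : ∀ n, map n (C.obj n).pt = (D.obj n).pt
  map_act : ∀ {n : ℕ+} (x : C.obj n) (σ : Equiv.Perm (Fin n)),
    map n (C.act x σ) = D.act (map n x) σ
  map_unit : map 1 C.unit = D.unit
  map_comp : ∀ {k : ℕ+} {n : Fin k → ℕ+} (c : C.obj k) (d : ∀ s, C.obj (n s)),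
    map (total n) (C.γ c d) = D.γ (map k c) fun s => map (n s) (d s)

/-- A morphism of 1-operads is an equivalence if it is a weak equivalence in every arity. -/
def OneOperadHom.IsEquivalence {C D : OneOperad} (f : OneOperadHom C D) : Prop :=
  ∀ n : ℕ+, IsWeakHomotopyEquiv (f.map n)

/-- Equivalence of 1-operads: being connected by a finite zigzag of morphisms of 1-operads each of
which is an equivalence. -/
def OneOperad.Equivalent : OneOperad → OneOperad → Prop :=
  Relation.EqvGen fun C D => ∃ f : OneOperadHom C D, f.IsEquivalence

/-! ### The quotient `X / B` -/

/-- The subset `B ⊔ {*}` of `X ⊔ {*}`. -/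
def baseSet {X : Type} (B : Set X) : Set (X ⊕ Unit) := Sum.inl '' B ∪ Set.range Sum.inr

/-- The relation on `X ⊔ {*}` that identifies all points of `B` with `*`. -/
def collapseSetoid {X : Type} (B : Set X) : Setoid (X ⊕ Unit) where
  r x y := x = y ∨ (x ∈ baseSet B ∧ y ∈ baseSet B)
  iseqv :=
    { refl := fun _ => Or.inl rfl
      symm := by
        rintro x y (h | h)
        · exact Or.inl h.symm
        · exact Or.inr h.symm
      trans := by
        rintro x y z (rfl | h) (rfl | h')
        · exact Or.inl rfl
        · exact Or.inr h'
        · exact Or.inr h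
        · exact Or.inr ⟨h.1, h'.2⟩ }

/-- The quotient `X / B`, with the quotient topology; as usual, `X / ∅` is `X` with a disjoint base
point added. -/
def Collapse {X : Type} (B : Set X) : Type := Quotient (collapseSetoid B)

namespace Collapse

variable {X : Type} {B : Set X}

/-- The quotient map from `X ⊔ {*}`. -/
def proj (B : Set X) (x : X ⊕ Unit) : Collapse B := Quotient.mk (collapseSetoid B) x

/-- The class of a point of `X`. -/
def mk (B : Set X) (x : X) : Collapse B := proj B (Sum.inl x)

/-- The base point. -/
def pt (B : Set X) : Collapse B := proj B (Sum.inr ())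

theorem proj_eq_iff {x y : X ⊕ Unit} : proj B x = proj B y ↔
    x = y ∨ (x ∈ baseSet B ∧ y ∈ baseSet B) :=
  Quotient.eq

theorem proj_eq_pt_iff {x : X ⊕ Unit} : proj B x = pt B ↔ x ∈ baseSet B := by
  unfold pt
  rw [proj_eq_iff]
  constructor
  · rintro (rfl | h)
    · exact Or.inr ⟨(), rfl⟩
    · exact h.1
  · intro h
    exact Or.inr ⟨h, Or.inr ⟨(), rfl⟩⟩

theorem mk_eq_pt_iff {x : X} : mk B x = pt B ↔ x ∈ B := by
  rw [mk, proj_eq_pt_iff]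
  simp [baseSet]

theorem mk_eq_mk_iff {x y : X} : mk B x = mk B y ↔ x = y ∨ (x ∈ B ∧ y ∈ B) := by
  rw [mk, mk, proj_eq_iff]
  simp [baseSet]

theorem eq_pt_or_eq_mk (z : Collapse B) : z = pt B ∨ ∃ x, z = mk B x := by
  induction z using Quotient.inductionOn with
  | h z =>
    rcases z with x | u
    · exact Or.inr ⟨x, rfl⟩
    · exact Or.inl rfl

variable [TopologicalSpace X]

instance : TopologicalSpace (Collapse B) :=
  inferInstanceAs (TopologicalSpace (Quotient (collapseSetoid B)))

theorem isQuotientMap_proj : Topology.IsQuotientMap (proj B) := isQuotientMap_quotient_mk'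

theorem isOpen_iff {s : Set (Collapse B)} : IsOpen s ↔ IsOpen {x | mk B x ∈ s} := by
  rw [← isQuotientMap_proj.isOpen_preimage, isOpen_sum_iff]
  exact and_iff_left (isOpen_discrete _)

instance [CompactlyGeneratedSpace X] : CompactlyGeneratedSpace (Collapse B) :=
  inferInstanceAs (CompactlyGeneratedSpace (Quotient (collapseSetoid B)))

theorem t2Space [T3Space X] (hB : IsClosed B) : T2Space (Collapse B) := by
  have key : ∀ x, x ∉ B → ∃ U V : Set (Collapse B), IsOpen U ∧ IsOpen V ∧ mk B x ∈ U ∧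
      pt B ∈ V ∧ Disjoint U V := by
    intro x hx
    obtain ⟨V, ⟨hV, hBV⟩, U, ⟨hxU, hU⟩, hd⟩ :=
      ((hasBasis_nhdsSet B).disjoint_iff (nhds_basis_opens x)).1 (RegularSpace.regular hB hx)
    refine ⟨mk B '' U, (mk B '' U)ᶜ ∩ (mk B '' Vᶜ)ᶜ, ?_, ?_, ⟨x, hxU, rfl⟩, ⟨?_, ?_⟩, ?_⟩
    · rw [isOpen_iff]
      convert! hU using 1
      ext y
      constructor
      · rintro ⟨u, hu, huy⟩
        rcases mk_eq_mk_iff.1 huy with rfl | h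
        · exact hu
        · exact (Set.disjoint_left.1 hd (hBV h.1) hu).elim
      · exact fun hy => ⟨y, hy, rfl⟩
    · rw [isOpen_iff]
      convert! hV using 1
      ext y
      constructor
      · rintro ⟨-, h2⟩
        by_contra hy
        exact h2 ⟨y, hy, rfl⟩
      · intro hy
        constructor
        · rintro ⟨u, hu, huy⟩
          rcases mk_eq_mk_iff.1 huy with rfl | h
          · exact Set.disjoint_left.1 hd hy hu
          · exact Set.disjoint_left.1 hd (hBV h.1) hu
        · rintro ⟨u, hu, huy⟩
          rcases mk_eq_mk_iff.1 huy with rfl | h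
          · exact hu hy
          · exact hu (hBV h.1)
    · rintro ⟨u, hu, hup⟩
      exact Set.disjoint_left.1 hd (hBV (mk_eq_pt_iff.1 hup)) hu
    · rintro ⟨u, hu, hup⟩
      exact hu (hBV (mk_eq_pt_iff.1 hup))
    · exact Set.disjoint_left.2 fun z hz hz' => hz'.1 hz
  refine ⟨fun z w hzw => ?_⟩
  by_cases hz : z = pt B
  · subst hz
    rcases eq_pt_or_eq_mk w with rfl | ⟨y, rfl⟩
    · exact (hzw rfl).elim
    · obtain ⟨U, V, hU, hV, h1, h2, hd⟩ := key y fun h => hzw (mk_eq_pt_iff.2 h).symm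
      exact ⟨V, U, hV, hU, h2, h1, hd.symm⟩
  by_cases hw : w = pt B
  · subst hw
    rcases eq_pt_or_eq_mk z with rfl | ⟨y, rfl⟩
    · exact (hzw rfl).elim
    · exact key y fun h => hzw (mk_eq_pt_iff.2 h)
  obtain ⟨x, rfl⟩ := (eq_pt_or_eq_mk z).resolve_left hz
  obtain ⟨y, rfl⟩ := (eq_pt_or_eq_mk w).resolve_left hw
  have hx : x ∉ B := fun h => hz (mk_eq_pt_iff.2 h)
  have hy : y ∉ B := fun h => hw (mk_eq_pt_iff.2 h)
  obtain ⟨U, V, hU, hV, hxU, hyV, hd⟩ := t2_separation fun h : x = y => hzw (congrArg (mk B) h)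
  have hopen : ∀ W : Set X, IsOpen W → IsOpen (mk B '' (W ∩ Bᶜ)) := by
    intro W hW
    rw [isOpen_iff]
    convert! hW.inter hB.isOpen_compl using 1
    ext y
    constructor
    · rintro ⟨u, hu, huy⟩
      rcases mk_eq_mk_iff.1 huy with rfl | h
      · exact hu
      · exact (hu.2 h.1).elim
    · exact fun hy => ⟨y, hy, rfl⟩
  refine ⟨_, _, hopen U hU, hopen V hV, ⟨x, ⟨hxU, hx⟩, rfl⟩, ⟨y, ⟨hyV, hy⟩, rfl⟩, ?_⟩
  rw [Set.disjoint_left]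
  rintro _ ⟨u, hu, rfl⟩ ⟨v, hv, hvu⟩
  rcases mk_eq_mk_iff.1 hvu with rfl | h
  · exact Set.disjoint_left.1 hd hu.1 hv.1
  · exact hv.2 h.1

/-- The quotient of a locally compact Hausdorff space by a closed set, as a based space. -/
def toBasedSpace [LocallyCompactSpace X] [T3Space X] (hB : IsClosed B) : BasedSpace where
  carrier := Collapse B
  weakHausdorff := by
    intro K _ _ _ f hf
    have := t2Space hB
    exact (isCompact_range hf).isClosed
  pt := pt B

end Collapse

theorem locallyCompactSpace_sum_unit {X : Type} [TopologicalSpace X] [LocallyCompactSpace X]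
    [T2Space X] : LocallyCompactSpace (X ⊕ Unit) := by
  have : WeaklyLocallyCompactSpace (X ⊕ Unit) := by
    refine ⟨?_⟩
    rintro (x | u)
    · obtain ⟨K, hK, hx⟩ := exists_compact_mem_nhds x
      exact ⟨Sum.inl '' K, hK.image continuous_inl, isOpenMap_inl.image_mem_nhds hx⟩
    · exact ⟨Set.range Sum.inr, isCompact_range continuous_inr,
        isOpen_range_inr.mem_nhds ⟨u, rfl⟩⟩
  infer_instance

theorem continuous_of_comp_quotient_aux {ι : Type} [Finite ι] {T X : ι → Type}
    [∀ i, TopologicalSpace (T i)] [∀ i, LocallyCompactSpace (T i)] [∀ i, Nonempty (T i)]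
    [∀ i, TopologicalSpace (X i)] {q : ∀ i, T i → X i} (hq : ∀ i, Topology.IsQuotientMap (q i))
    {R : Type} [TopologicalSpace R] (g : (∀ i, X i) → R)
    (hg : Continuous fun t : ∀ i, T i => g fun i => q i (t i))
    {K : Type} [TopologicalSpace K] [CompactSpace K] [T2Space K] (f : K → ∀ i, X i)
    (hf : Continuous f) : Continuous fun x => g (f x) := by
  classical
  have := Fintype.ofFinite ι
  have key : ∀ S : Finset ι, Continuous fun p : (∀ i, T i) × K =>
      g fun i => if i ∈ S then f p.2 i else q i (p.1 i) := by
    intro S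
    induction S using Finset.induction_on with
    | empty => simpa [Function.comp_def] using hg.comp continuous_fst
    | insert r S hr ih =>
      have h1 : Continuous fun p : X r × ((∀ i, T i) × K) =>
          g (Function.update (fun i => if i ∈ S then f p.2.2 i else q i (p.2.1 i)) r p.1) := by
        refine (hq r).continuous_lift_prod_left (g := fun p : X r × ((∀ i, T i) × K) =>
          g (Function.update (fun i => if i ∈ S then f p.2.2 i else q i (p.2.1 i)) r p.1)) ?_
        have h2 : Continuous fun p : T r × ((∀ i, T i) × K) =>
            ((Function.update p.2.1 r p.1 : ∀ i, T i), p.2.2) :=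
          (Continuous.update (continuous_fst.comp continuous_snd) r continuous_fst).prodMk
            (continuous_snd.comp continuous_snd)
        convert! ih.comp h2 using 2 with p
        simp only [Function.comp]
        congr 1
        funext i
        by_cases hi : i = r
        · subst hi
          simp [hr]
        · simp [hi]
      have h3 : Continuous fun p : (∀ i, T i) × K => ((f p.2 r, p) : X r × ((∀ i, T i) × K)) :=
        ((continuous_apply r).comp (hf.comp continuous_snd)).prodMk continuous_id
      convert! h1.comp h3 using 2 with p
      simp only [Function.comp]
      congr 1
      funext i
      by_cases hi : i = r
      · subst hi
        simp
      · simp [hi]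
  have h4 := (key Finset.univ).comp
    (Continuous.prodMk_right (X := ∀ i, T i) (Y := K) fun i => Classical.arbitrary (T i))
  simpa [Function.comp_def] using h4

/-- A map out of a product of quotients of locally compact spaces is continuous for the compactly
generated product topology as soon as it is continuous on representatives. -/
theorem continuous_of_comp_quotient {ι : Type} [Finite ι] {T : ι → Type}
    [∀ i, TopologicalSpace (T i)] [∀ i, LocallyCompactSpace (T i)] [∀ i, Nonempty (T i)]
    {X : ι → BasedSpace} {q : ∀ i, T i → X i} (hq : ∀ i, Topology.IsQuotientMap (q i))
    {R : Type} [TopologicalSpace R] (g : BasedSpace.KProd X → R)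
    (hg : Continuous fun t : ∀ i, T i => g fun i => q i (t i)) : Continuous g :=
  continuous_from_compactlyGenerated (X := ∀ i, X i) g fun K f =>
    continuous_of_comp_quotient_aux (K := K) hq g hg f f.continuous

/-! ### 1-operads of tuples -/

theorem blockPerm_blockEquiv {k : ℕ+} (n : Fin k → ℕ+) (σ : Equiv.Perm (Fin k)) (s : Fin k)
    (r : Fin (n (σ s))) :
    blockPerm n σ (Fin.cast (congrArg PNat.val (total_comp_perm n σ))
      (blockEquiv (fun s => n (σ s)) ⟨s, r⟩)) = blockEquiv n ⟨σ s, r⟩ := by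
  simp [blockPerm, Equiv.sigmaCongrLeft]

theorem sumPerm_blockEquiv {k : ℕ+} (n : Fin k → ℕ+) (τ : ∀ s, Equiv.Perm (Fin (n s)))
    (s : Fin k) (r : Fin (n s)) :
    sumPerm n τ (blockEquiv n ⟨s, r⟩) = blockEquiv n ⟨s, τ s r⟩ := by
  simp [sumPerm]

theorem blockEquiv_val {k : ℕ+} (n : Fin k → ℕ+) (s : Fin k) (r : Fin (n s)) :
    (blockEquiv n ⟨s, r⟩ : ℕ) = (∑ s', if s' < s then (n s' : ℕ) else 0) + r := by
  unfold blockEquiv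
  refine (finSigmaFinEquiv_apply (n := fun s => (n s : ℕ)) ⟨s, r⟩).trans ?_
  congr 1
  rw [← Finset.sum_filter]
  refine Finset.sum_bij (fun i _ => Fin.castLE s.2.le i) ?_ ?_ ?_ ?_
  · intro i _
    exact Finset.mem_filter.2 ⟨Finset.mem_univ _, i.2⟩
  · intro i _ j _ h
    exact Fin.castLE_injective _ h
  · intro i hi
    exact ⟨⟨i, (Finset.mem_filter.1 hi).2⟩, Finset.mem_univ _, rfl⟩
  · intro i _
    rfl

theorem blockEquiv_lt_of_lt {k : ℕ+} (n : Fin k → ℕ+) {s s' : Fin k} (h : s' < s)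
    (q : Fin (n s)) (q' : Fin (n s')) : blockEquiv n ⟨s', q'⟩ < blockEquiv n ⟨s, q⟩ := by
  rw [Fin.lt_def, blockEquiv_val, blockEquiv_val]
  have h1 : (∑ t, if t < s' then (n t : ℕ) else 0) + (∑ t, if t = s' then (n t : ℕ) else 0) ≤
      ∑ t, if t < s then (n t : ℕ) else 0 := by
    rw [← Finset.sum_add_distrib]
    refine Finset.sum_le_sum fun t _ => ?_
    by_cases h1 : t < s'
    · simp [h1, h1.ne, h1.trans h]
    · by_cases h2 : t = s'
      · subst h2
        simp [h]
      · simp [h1, h2]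
  rw [Finset.sum_ite_eq' Finset.univ s'] at h1
  simp only [Finset.mem_univ, if_true] at h1
  have := q'.2
  omega

theorem blockEquiv_lt_iff {k : ℕ+} (n : Fin k → ℕ+) (s s' : Fin k)
    (q : Fin (n s)) (q' : Fin (n s')) :
    blockEquiv n ⟨s', q'⟩ < blockEquiv n ⟨s, q⟩ ↔ s' < s ∨ (s' = s ∧ (q' : ℕ) < q) := by
  rcases lt_trichotomy s' s with h | h | h
  · simp [h, blockEquiv_lt_of_lt n h q q']
  · subst h
    rw [Fin.lt_def, blockEquiv_val, blockEquiv_val]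
    simp
  · simp [h.not_gt, h.ne', (blockEquiv_lt_of_lt n h q' q).le]

theorem blockEquiv_assoc {k : ℕ+} (n : Fin k → ℕ+) (i : Fin (total n) → ℕ+) (s : Fin k)
    (q : Fin (n s)) (r : Fin (i (blockEquiv n ⟨s, q⟩))) :
    (blockEquiv (fun s => total fun q => i (blockEquiv n ⟨s, q⟩))
        ⟨s, blockEquiv (fun q => i (blockEquiv n ⟨s, q⟩)) ⟨q, r⟩⟩ : ℕ) =
      blockEquiv i ⟨blockEquiv n ⟨s, q⟩, r⟩ := by
  rw [blockEquiv_val, blockEquiv_val, blockEquiv_val, ← add_assoc]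
  congr 1
  rw [← (blockEquiv n).sum_comp, Fintype.sum_sigma]
  have h : ∀ s' : Fin k, (∑ q' : Fin (n s'),
      if blockEquiv n ⟨s', q'⟩ < blockEquiv n ⟨s, q⟩ then (i (blockEquiv n ⟨s', q'⟩) : ℕ) else 0) =
      (if s' < s then ∑ q', (i (blockEquiv n ⟨s', q'⟩) : ℕ) else 0) +
      (if s' = s then ∑ q' : Fin (n s'),
        if (q' : ℕ) < q then (i (blockEquiv n ⟨s', q'⟩) : ℕ) else 0 else 0) := by
    intro s'
    simp only [blockEquiv_lt_iff]
    rcases lt_trichotomy s' s with h | h | h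
    · simp [h, h.ne]
    · subst h
      simp
    · simp [h.not_gt, h.ne']
  rw [Finset.sum_congr rfl fun s' _ => h s', Finset.sum_add_distrib,
    Finset.sum_ite_eq' Finset.univ s]
  simp only [Finset.mem_univ, if_true]
  rfl

section Tuples

variable {M : Type} [Monoid M]

/-- The tuple `(c₁ d₁₁, …, c₁ d₁ₙ₁, …, c_k d_k₁, …, c_k d_kₙₖ)`. -/
def blockMul {k : ℕ+} {n : Fin k → ℕ+} (c : Fin k → M) (d : ∀ s, Fin (n s) → M) :
    Fin (total n) → M :=
  fun t => c ((blockEquiv n).symm t).1 * d ((blockEquiv n).symm t).1 ((blockEquiv n).symm t).2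

theorem blockMul_blockEquiv {k : ℕ+} {n : Fin k → ℕ+} (c : Fin k → M)
    (d : ∀ s, Fin (n s) → M) (s : Fin k) (r : Fin (n s)) :
    blockMul c d (blockEquiv n ⟨s, r⟩) = c s * d s r := by
  unfold blockMul
  rw [Equiv.symm_apply_apply]

variable (M) in
/-- For every `n ≥ 1`, closed sets `A n`, `B n` of `n`-tuples in a topological monoid such that
block multiplication and permutation of coordinates induce the structure of a 1-operad on the
quotients `A n / (A n ∩ B n)`. -/
structure TupleSystem [TopologicalSpace M] where
  A : ∀ n : ℕ+, Set (Fin n → M)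
  B : ∀ n : ℕ+, Set (Fin n → M)
  isClosed_A : ∀ n, IsClosed (A n)
  isClosed_B : ∀ n, IsClosed (B n)
  perm_A : ∀ {n : ℕ+} {x : Fin n → M} (σ : Equiv.Perm (Fin n)), x ∈ A n → x ∘ σ ∈ A n
  perm_B : ∀ {n : ℕ+} {x : Fin n → M} (σ : Equiv.Perm (Fin n)), x ∈ B n → x ∘ σ ∈ B n
  one_A : (fun _ => 1) ∈ A 1
  mul_A : ∀ {k : ℕ+} {n : Fin k → ℕ+} {c : Fin k → M} {d : ∀ s, Fin (n s) → M},
    c ∈ A k → (∀ s, d s ∈ A (n s)) → blockMul c d ∈ A (total n)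
  mul_B_left : ∀ {k : ℕ+} {n : Fin k → ℕ+} {c : Fin k → M} {d : ∀ s, Fin (n s) → M},
    c ∈ A k → (∀ s, d s ∈ A (n s)) → c ∈ B k → blockMul c d ∈ B (total n)
  mul_B_right : ∀ {k : ℕ+} {n : Fin k → ℕ+} {c : Fin k → M} {d : ∀ s, Fin (n s) → M} (s : Fin k),
    c ∈ A k → (∀ s, d s ∈ A (n s)) → d s ∈ B (n s) → blockMul c d ∈ B (total n)

namespace TupleSystem

variable [TopologicalSpace M] (S : TupleSystem M)

/-- The subset `A n ∩ B n` of `A n`. -/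
def base (n : ℕ+) : Set (S.A n) := {x | x.1 ∈ S.B n}

/-- The composition on representatives. -/
noncomputable def compFun {k : ℕ+} (n : Fin k → ℕ+) (c : S.A k ⊕ Unit)
    (d : ∀ s, S.A (n s) ⊕ Unit) : Collapse (S.base (total n)) :=
  open Classical in
  if h : ∃ (a : S.A k) (b : ∀ s, S.A (n s)), c = Sum.inl a ∧ ∀ s, d s = Sum.inl (b s) then
    Collapse.mk (S.base (total n))
      ⟨blockMul h.choose.1 fun s => (h.choose_spec.choose s).1,
        S.mul_A h.choose.2 fun s => (h.choose_spec.choose s).2⟩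
  else Collapse.pt (S.base (total n))

theorem compFun_inl {k : ℕ+} {n : Fin k → ℕ+} (a : S.A k) (b : ∀ s, S.A (n s)) :
    S.compFun n (Sum.inl a) (fun s => Sum.inl (b s)) =
      Collapse.mk (S.base (total n))
        ⟨blockMul a.1 fun s => (b s).1, S.mul_A a.2 fun s => (b s).2⟩ := by
  have h : ∃ (a' : S.A k) (b' : ∀ s, S.A (n s)), (Sum.inl a : S.A k ⊕ Unit) = Sum.inl a' ∧
      ∀ s, (Sum.inl (b s) : S.A (n s) ⊕ Unit) = Sum.inl (b' s) := ⟨a, b, rfl, fun _ => rfl⟩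
  have h1 : h.choose = a := (Sum.inl_injective h.choose_spec.choose_spec.1).symm
  have h2 : h.choose_spec.choose = b :=
    funext fun s => (Sum.inl_injective (h.choose_spec.choose_spec.2 s)).symm
  unfold compFun
  rw [dif_pos h]
  congr 2
  rw [h2, h1]

theorem compFun_inr_left {k : ℕ+} {n : Fin k → ℕ+} (u : Unit) (d : ∀ s, S.A (n s) ⊕ Unit) :
    S.compFun n (Sum.inr u) d = Collapse.pt (S.base (total n)) := by
  unfold compFun
  rw [dif_neg]
  rintro ⟨a, b, h, -⟩
  cases h

theorem compFun_inr_right {k : ℕ+} {n : Fin k → ℕ+} (c : S.A k ⊕ Unit)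
    (d : ∀ s, S.A (n s) ⊕ Unit) (s : Fin k) (u : Unit) (hs : d s = Sum.inr u) :
    S.compFun n c d = Collapse.pt (S.base (total n)) := by
  unfold compFun
  rw [dif_neg]
  rintro ⟨a, b, -, h⟩
  cases hs.symm.trans (h s)

theorem compFun_cases {k : ℕ+} {n : Fin k → ℕ+} (c : S.A k ⊕ Unit)
    (d : ∀ s, S.A (n s) ⊕ Unit) :
    (∃ (a : S.A k) (b : ∀ s, S.A (n s)), c = Sum.inl a ∧ d = fun s => Sum.inl (b s)) ∨
      S.compFun n c d = Collapse.pt (S.base (total n)) := by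
  by_cases h : ∃ (a : S.A k) (b : ∀ s, S.A (n s)), c = Sum.inl a ∧ ∀ s, d s = Sum.inl (b s)
  · obtain ⟨a, b, h1, h2⟩ := h
    exact Or.inl ⟨a, b, h1, funext h2⟩
  · right
    unfold compFun
    rw [dif_neg h]

theorem compFun_base_left {k : ℕ+} {n : Fin k → ℕ+} (c : S.A k ⊕ Unit)
    (d : ∀ s, S.A (n s) ⊕ Unit) (hc : c ∈ baseSet (S.base k)) :
    S.compFun n c d = Collapse.pt (S.base (total n)) := by
  rcases S.compFun_cases c d with ⟨a, b, rfl, rfl⟩ | h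
  · have ha : a.1 ∈ S.B k := by simpa [baseSet, base] using hc
    rw [compFun_inl, Collapse.mk_eq_pt_iff]
    exact S.mul_B_left a.2 (fun s => (b s).2) ha
  · exact h

theorem compFun_base_right {k : ℕ+} {n : Fin k → ℕ+} (c : S.A k ⊕ Unit)
    (d : ∀ s, S.A (n s) ⊕ Unit) (s : Fin k) (hs : d s ∈ baseSet (S.base (n s))) :
    S.compFun n c d = Collapse.pt (S.base (total n)) := by
  rcases S.compFun_cases c d with ⟨a, b, rfl, rfl⟩ | h
  · have hb : (b s).1 ∈ S.B (n s) := by simpa [baseSet, base] using hs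
    rw [compFun_inl, Collapse.mk_eq_pt_iff]
    exact S.mul_B_right s a.2 (fun s => (b s).2) hb
  · exact h

theorem compFun_congr {k : ℕ+} {n : Fin k → ℕ+} {c c' : S.A k ⊕ Unit}
    {d d' : ∀ s, S.A (n s) ⊕ Unit}
    (hc : Collapse.proj (S.base k) c = Collapse.proj (S.base k) c')
    (hd : ∀ s, Collapse.proj (S.base (n s)) (d s) = Collapse.proj (S.base (n s)) (d' s)) :
    S.compFun n c d = S.compFun n c' d' := by
  rcases Collapse.proj_eq_iff.1 hc with rfl | hc
  · by_cases h : ∃ s, d s ∈ baseSet (S.base (n s)) ∧ d' s ∈ baseSet (S.base (n s))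
    · obtain ⟨s, h, h'⟩ := h
      rw [S.compFun_base_right c d s h, S.compFun_base_right c d' s h']
    · have : d = d' := funext fun s =>
        (Collapse.proj_eq_iff.1 (hd s)).resolve_right fun hs => h ⟨s, hs⟩
      rw [this]
  · rw [S.compFun_base_left c d hc.1, S.compFun_base_left c' d' hc.2]

theorem continuous_compFun [ContinuousMul M] {k : ℕ+} (n : Fin k → ℕ+) :
    Continuous fun p : (S.A k ⊕ Unit) × ∀ s, S.A (n s) ⊕ Unit => S.compFun n p.1 p.2 := by
  set P := (S.A k ⊕ Unit) × ∀ s, S.A (n s) ⊕ Unit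
  have hval : ∀ m : ℕ+, Continuous (Sum.elim Subtype.val (fun _ _ => 1) :
      S.A m ⊕ Unit → Fin m → M) := fun m =>
    Continuous.sumElim continuous_subtype_val continuous_const
  have hleft : ∀ m : ℕ+, IsClopen (Set.range (Sum.inl : S.A m → S.A m ⊕ Unit)) := fun m =>
    ⟨isClosed_range_inl, isOpen_range_inl⟩
  let U : Set P := Prod.fst ⁻¹' Set.range Sum.inl ∩
    ⋂ s, (fun p : P => p.2 s) ⁻¹' Set.range Sum.inl
  have hU : IsClopen U :=
    ((hleft k).preimage continuous_fst).inter (isClopen_iInter_of_finite fun s =>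
      (hleft (n s)).preimage ((continuous_apply s).comp continuous_snd))
  have hmem : ∀ p : U, (fun t => blockMul (Sum.elim Subtype.val (fun _ _ => 1) p.1.1)
      (fun s => Sum.elim Subtype.val (fun _ _ => 1) (p.1.2 s)) t) ∈ S.A (total n) := by
    rintro ⟨⟨c, d⟩, hp⟩
    obtain ⟨a, ha⟩ := hp.1
    obtain rfl : Sum.inl a = c := ha
    have h := hp.2
    refine S.mul_A a.2 fun s => ?_
    obtain ⟨b, hb⟩ := Set.mem_iInter.1 h s
    simp only at hb
    simp only [← hb]
    exact b.2
  have hcont : Continuous fun p : U => Collapse.mk (S.base (total n)) ⟨_, hmem p⟩ := by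
    refine (Collapse.isQuotientMap_proj.continuous.comp continuous_inl).comp
      (Continuous.subtype_mk ?_ _)
    refine continuous_pi fun t => Continuous.mul ?_ ?_
    · exact (continuous_apply _).comp ((hval k).comp (continuous_fst.comp continuous_subtype_val))
    · exact (continuous_apply _).comp ((hval _).comp ((continuous_apply _).comp
        (continuous_snd.comp continuous_subtype_val)))
  rw [continuous_iff_continuousAt]
  intro p
  by_cases hp : p ∈ U
  · have hon : ContinuousOn (fun p : P => S.compFun n p.1 p.2) U := by
      rw [continuousOn_iff_continuous_domRestrict]
      convert! hcont using 2 with p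
      obtain ⟨⟨c, d⟩, hp⟩ := p
      obtain ⟨a, ha⟩ := hp.1
      obtain rfl : Sum.inl a = c := ha
      have h' : ∀ s, ∃ b, Sum.inl b = d s := fun s => Set.mem_iInter.1 hp.2 s
      choose b hb using h'
      obtain rfl : (fun s => Sum.inl (b s)) = d := funext hb
      exact S.compFun_inl a b
    exact hon.continuousAt (hU.isOpen.mem_nhds hp)
  · have heq : (fun _ : P => Collapse.pt (S.base (total n))) =ᶠ[𝓝 p]
        fun p : P => S.compFun n p.1 p.2 := by
      filter_upwards [hU.compl.isOpen.mem_nhds hp] with p' hp'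
      rcases S.compFun_cases p'.1 p'.2 with ⟨a, b, h1, h2⟩ | h
      · refine (hp' ⟨⟨a, h1.symm⟩, Set.mem_iInter.2 fun s => ⟨b s, ?_⟩⟩).elim
        exact (congrFun h2 s).symm
      · exact h.symm
    exact continuousAt_const.congr heq

variable [LocallyCompactSpace M] [T3Space M]

/-- The based space `A n / (A n ∩ B n)`. -/
noncomputable def space (n : ℕ+) : BasedSpace :=
  have := (S.isClosed_A n).locallyCompactSpace
  Collapse.toBasedSpace (B := S.base n) ((S.isClosed_B n).preimage continuous_subtype_val)

/-- The class of an element of `A n`. -/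
noncomputable def cls {n : ℕ+} (x : S.A n) : S.space n := Collapse.mk (S.base n) x

theorem space_cases {n : ℕ+} (z : S.space n) : z = (S.space n).pt ∨ ∃ x, z = S.cls x :=
  Collapse.eq_pt_or_eq_mk (B := S.base n) z

theorem cls_eq_pt {n : ℕ+} {x : S.A n} (hx : x.1 ∈ S.B n) : S.cls x = (S.space n).pt :=
  Collapse.mk_eq_pt_iff (B := S.base n).2 hx

/-- The quotient map onto `A n / (A n ∩ B n)`. -/
noncomputable def projMap (n : ℕ+) (x : S.A n ⊕ Unit) : S.space n := Collapse.proj (S.base n) x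

theorem isQuotientMap_projMap (n : ℕ+) : Topology.IsQuotientMap (S.projMap n) :=
  Collapse.isQuotientMap_proj

/-- A representative of a point of the quotient. -/
noncomputable def rep {n : ℕ+} (z : S.space n) : S.A n ⊕ Unit :=
  Quotient.out (s := collapseSetoid (S.base n)) z

theorem projMap_rep {n : ℕ+} (z : S.space n) : S.projMap n (S.rep z) = z :=
  Quotient.out_eq (s := collapseSetoid (S.base n)) z

theorem rep_pt (n : ℕ+) : S.rep (S.space n).pt ∈ baseSet (S.base n) :=
  Collapse.proj_eq_pt_iff.1 (S.projMap_rep (S.space n).pt)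

/-- The action of the symmetric groups by permutation of coordinates, `(x σ) i = x (σ i)`. -/
noncomputable def actMap {n : ℕ+} (z : S.space n) (σ : Equiv.Perm (Fin n)) : S.space n :=
  Quotient.lift (s := collapseSetoid (S.base n))
    (fun x : S.A n ⊕ Unit =>
      S.projMap n (Sum.map (fun y : S.A n => (⟨y.1 ∘ σ, S.perm_A σ y.2⟩ : S.A n)) id x))
    (by
      have key : ∀ x ∈ baseSet (S.base n), S.projMap n (Sum.map
          (fun y : S.A n => (⟨y.1 ∘ σ, S.perm_A σ y.2⟩ : S.A n)) id x) = (S.space n).pt := by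
        rintro x (⟨y, hy, rfl⟩ | ⟨u, rfl⟩)
        · exact S.cls_eq_pt (S.perm_B σ hy)
        · rfl
      rintro x y (rfl | h)
      · rfl
      · exact (key x h.1).trans (key y h.2).symm) z

theorem actMap_cls {n : ℕ+} (x : S.A n) (σ : Equiv.Perm (Fin n)) :
    S.actMap (S.cls x) σ = S.cls ⟨x.1 ∘ σ, S.perm_A σ x.2⟩ := rfl

theorem actMap_pt {n : ℕ+} (σ : Equiv.Perm (Fin n)) :
    S.actMap (S.space n).pt σ = (S.space n).pt := rfl

theorem continuous_actMap {n : ℕ+} (σ : Equiv.Perm (Fin n)) :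
    Continuous fun z : S.space n => S.actMap z σ := by
  rw [(S.isQuotientMap_projMap n).continuous_iff]
  change Continuous fun x : S.A n ⊕ Unit => S.projMap n (Sum.map
    (fun y : S.A n => (⟨y.1 ∘ σ, S.perm_A σ y.2⟩ : S.A n)) id x)
  refine (S.isQuotientMap_projMap n).continuous.comp (Continuous.sumMap ?_ continuous_id)
  refine Continuous.subtype_mk ?_ _
  exact continuous_pi fun i => (continuous_apply (σ i)).comp continuous_subtype_val

/-- The composition as a map from the smash product. -/
noncomputable def compMap {k : ℕ+} (n : Fin k → ℕ+) :
    BasedSpace.Smash (compFamily S.space n) → S.space (total n) :=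
  Quotient.lift (s := BasedSpace.smashSetoid (compFamily S.space n))
    (fun z => S.compFun n (S.rep (z none)) fun s => S.rep (z (some s)))
    (by
      have key : ∀ z : BasedSpace.KProd (compFamily S.space n),
          (∃ i, z i = (compFamily S.space n i).pt) →
          S.compFun n (S.rep (z none)) (fun s => S.rep (z (some s))) =
            Collapse.pt (S.base (total n)) := by
        rintro z ⟨_ | s, hz⟩
        · exact S.compFun_base_left _ _ (by rw [hz]; exact S.rep_pt k)
        · exact S.compFun_base_right _ _ s (by rw [hz]; exact S.rep_pt (n s))
      rintro x y (rfl | h)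
      · rfl
      · exact (key x h.1).trans (key y h.2).symm)

theorem continuous_compMap [ContinuousMul M] {k : ℕ+} (n : Fin k → ℕ+) :
    Continuous (S.compMap n) := by
  refine Continuous.quotient_lift ?_ _
  let T : Option (Fin k) → Type := fun j => S.A (j.elim k n) ⊕ Unit
  have : ∀ j, LocallyCompactSpace (T j) := fun j =>
    have := (S.isClosed_A (j.elim k n)).locallyCompactSpace
    locallyCompactSpace_sum_unit
  have : ∀ j, Nonempty (T j) := fun j => ⟨Sum.inr ()⟩
  let q : ∀ j, T j → compFamily S.space n j
    | none => S.projMap k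
    | some s => S.projMap (n s)
  have hq : ∀ j, Topology.IsQuotientMap (q j)
    | none => S.isQuotientMap_projMap k
    | some s => S.isQuotientMap_projMap (n s)
  refine continuous_of_comp_quotient hq _ ?_
  have h : Continuous fun t : ∀ j, T j =>
      S.compFun n (t none : S.A k ⊕ Unit) (fun s => (t (some s) : S.A (n s) ⊕ Unit)) :=
    (S.continuous_compFun n).comp
      (Continuous.prodMk (continuous_apply (A := T) none)
        (continuous_pi fun s => continuous_apply (A := T) (some s)))
  refine h.congr fun t => ?_
  exact (S.compFun_congr (S.projMap_rep (S.projMap k (t none)))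
    fun s => S.projMap_rep (S.projMap (n s) (t (some s)))).symm

/-- The structure maps of the 1-operad with spaces `A n / (A n ∩ B n)`. -/
noncomputable def operadData : OneOperadData where
  obj := S.space
  act := S.actMap
  unit := S.cls ⟨fun _ => 1, S.one_A⟩
  comp := S.compMap

theorem γ_cls {k : ℕ+} {n : Fin k → ℕ+} (c : S.A k) (d : ∀ s, S.A (n s)) :
    S.operadData.γ (S.cls c) (fun s => S.cls (d s)) =
      S.cls ⟨blockMul c.1 fun s => (d s).1, S.mul_A c.2 fun s => (d s).2⟩ := by
  refine Eq.trans ?_ (S.compFun_inl c d)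
  exact S.compFun_congr (S.projMap_rep (S.cls c)) fun s => S.projMap_rep (S.cls (d s))

theorem γ_pt_left {k : ℕ+} {n : Fin k → ℕ+} (d : ∀ s, S.space (n s)) :
    S.operadData.γ (S.space k).pt d = (S.space (total n)).pt :=
  S.compFun_base_left _ _ (S.rep_pt k)

theorem γ_pt_right {k : ℕ+} {n : Fin k → ℕ+} (c : S.space k) (d : ∀ s, S.space (n s))
    (s : Fin k) (hs : d s = (S.space (n s)).pt) :
    S.operadData.γ c d = (S.space (total n)).pt :=
  S.compFun_base_right _ _ s (by
    have := S.rep_pt (n s)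
    rwa [← hs] at this)

theorem arityCast_pt {m n : ℕ+} (h : m = n) :
    arityCast S.space h (S.space m).pt = (S.space n).pt := by
  subst h
  rfl

theorem arityCast_cls {m n : ℕ+} (h : m = n) (x : S.A m) (y : S.A n)
    (hxy : ∀ t : Fin m, x.1 t = y.1 (Fin.cast (congrArg PNat.val h) t)) :
    arityCast S.space h (S.cls x) = S.cls y := by
  subst h
  exact congrArg S.cls (Subtype.ext (funext hxy))

theorem exists_cls {k : ℕ+} {n : Fin k → ℕ+} (d : ∀ s, S.space (n s)) :
    (∃ s, d s = (S.space (n s)).pt) ∨ ∃ y : ∀ s, S.A (n s), d = fun s => S.cls (y s) := by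
  by_cases h : ∃ s, d s = (S.space (n s)).pt
  · exact Or.inl h
  · have h' : ∀ s, ∃ y, d s = S.cls y := fun s =>
      (S.space_cases (d s)).resolve_left fun hs => h ⟨s, hs⟩
    choose y hy using h'
    exact Or.inr ⟨y, funext hy⟩

/-- The 1-operad with spaces `A n / (A n ∩ B n)`, where the symmetric groups act by permutation of
coordinates and the composition is induced by block multiplication. -/
noncomputable def operad [ContinuousMul M] : OneOperad where
  toOneOperadData := S.operadData
  continuous_act := S.continuous_actMap
  act_pt := S.actMap_pt
  act_one := by
    intro n x
    rcases S.space_cases x with rfl | ⟨x, rfl⟩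
    · rfl
    · rfl
  act_mul := by
    intro n x σ τ
    rcases S.space_cases x with rfl | ⟨x, rfl⟩
    · rfl
    · rfl
  continuous_comp := S.continuous_compMap
  comp_pt := fun n => S.γ_pt_left (n := n) fun s => (S.space (n s)).pt
  assoc := by
    intro k n i c d e
    rcases S.space_cases c with rfl | ⟨c, rfl⟩
    · erw [S.γ_pt_left, S.γ_pt_left, S.γ_pt_left, S.arityCast_pt]
    rcases S.exists_cls d with ⟨s, hs⟩ | ⟨d, rfl⟩
    · erw [S.γ_pt_right _ d s hs, S.γ_pt_left, S.γ_pt_right _ _ s, S.arityCast_pt]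
      rw [hs]
      exact S.γ_pt_left _
    rcases S.exists_cls e with ⟨t, ht⟩ | ⟨e, rfl⟩
    · obtain ⟨⟨s, q⟩, rfl⟩ := (blockEquiv n).surjective t
      erw [S.γ_pt_right _ e _ ht, S.γ_pt_right _ _ s, S.arityCast_pt]
      exact S.γ_pt_right _ _ q ht
    have h1 : ∀ s, S.operadData.γ (S.cls (d s)) (fun q => S.cls (e (blockEquiv n ⟨s, q⟩))) =
        S.cls _ := fun s => S.γ_cls (d s) fun q => e (blockEquiv n ⟨s, q⟩)
    have h2 := S.γ_cls c d
    refine (congrArg (fun z => S.operadData.γ z fun t => S.cls (e t)) h2).trans ?_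
    refine (S.γ_cls _ e).trans ?_
    refine Eq.trans ?_ (congrArg (fun z => arityCast S.space (total_total n i)
      (S.operadData.γ (S.cls c) z)) (funext h1)).symm
    refine Eq.trans ?_ (congrArg (arityCast S.space (total_total n i)) (S.γ_cls c _)).symm
    refine (S.arityCast_cls _ _ _ fun t => ?_).symm
    obtain ⟨⟨s, v⟩, rfl⟩ := (blockEquiv _).surjective t
    obtain ⟨⟨q, r⟩, rfl⟩ := (blockEquiv _).surjective v
    have h3 : Fin.cast (congrArg PNat.val (total_total n i))
        (blockEquiv (fun s => total fun q => i (blockEquiv n ⟨s, q⟩))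
          ⟨s, blockEquiv (fun q => i (blockEquiv n ⟨s, q⟩)) ⟨q, r⟩⟩) =
        blockEquiv i ⟨blockEquiv n ⟨s, q⟩, r⟩ := Fin.ext (blockEquiv_assoc n i s q r)
    simp only [h3, blockMul_blockEquiv, mul_assoc]
  unit_left := by
    intro n d
    rcases S.space_cases d with rfl | ⟨d, rfl⟩
    · erw [S.γ_pt_right _ _ 0 rfl, S.arityCast_pt]
    refine (congrArg (arityCast S.space _) (S.γ_cls _ fun _ => d)).trans ?_
    refine S.arityCast_cls _ _ _ fun t => ?_
    obtain ⟨⟨s, r⟩, rfl⟩ := (blockEquiv _).surjective t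
    simp only [blockMul_blockEquiv, one_mul]
    refine congrArg d.1 (Fin.ext ?_)
    have : s = 0 := Subsingleton.elim (α := Fin 1) _ _
    subst this
    exact ((blockEquiv_val (fun _ : Fin (1 : ℕ+) => n) 0 r).trans (by simp)).symm
  unit_right := by
    intro k c
    rcases S.space_cases c with rfl | ⟨c, rfl⟩
    · erw [S.γ_pt_left, S.arityCast_pt]
    refine (congrArg (arityCast S.space _) (S.γ_cls c fun _ => _)).trans ?_
    refine S.arityCast_cls _ _ _ fun t => ?_
    obtain ⟨⟨s, r⟩, rfl⟩ := (blockEquiv _).surjective t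
    simp only [blockMul_blockEquiv, mul_one]
    refine congrArg c.1 (Fin.ext ?_)
    have : r = 0 := Subsingleton.elim (α := Fin 1) _ _
    subst this
    exact ((blockEquiv_val (fun _ : Fin k => (1 : ℕ+)) s 0).trans (by
      simp [Finset.filter_gt_eq_Iio])).symm
  equivariant_outer := by
    intro k n c d σ
    rcases S.space_cases c with rfl | ⟨c, rfl⟩
    · exact (congrArg (arityCast S.space _) (S.γ_pt_left _)).trans ((S.arityCast_pt _).trans
        (congrArg (fun z => S.actMap z (blockPerm n σ)) (S.γ_pt_left d)).symm)
    rcases S.exists_cls d with ⟨s, hs⟩ | ⟨d, rfl⟩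
    · obtain ⟨s, rfl⟩ := σ.surjective s
      exact (congrArg (arityCast S.space _) (S.γ_pt_right _ _ s hs)).trans
        ((S.arityCast_pt _).trans
          (congrArg (fun z => S.actMap z (blockPerm n σ)) (S.γ_pt_right _ d _ hs)).symm)
    refine (congrArg (arityCast S.space _) (S.γ_cls _ fun s => d (σ s))).trans ?_
    refine Eq.trans ?_ (congrArg (fun z => S.actMap z (blockPerm n σ)) (S.γ_cls c d)).symm
    refine S.arityCast_cls _ _ _ fun t => ?_
    obtain ⟨⟨s, r⟩, rfl⟩ := (blockEquiv _).surjective t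
    simp only [blockMul_blockEquiv, Function.comp_apply, blockPerm_blockEquiv]
  equivariant_inner := by
    intro k n c d τ
    rcases S.space_cases c with rfl | ⟨c, rfl⟩
    · exact (S.γ_pt_left _).trans
        (congrArg (fun z => S.actMap z (sumPerm n τ)) (S.γ_pt_left d)).symm
    rcases S.exists_cls d with ⟨s, hs⟩ | ⟨d, rfl⟩
    · refine (S.γ_pt_right _ _ s ?_).trans
        (congrArg (fun z => S.actMap z (sumPerm n τ)) (S.γ_pt_right _ d _ hs)).symm
      rw [hs]
      exact S.actMap_pt _
    refine (S.γ_cls c fun s => _).trans ?_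
    refine Eq.trans ?_ (congrArg (fun z => S.actMap z (sumPerm n τ)) (S.γ_cls c d)).symm
    refine congrArg S.cls (Subtype.ext (funext fun t => ?_))
    obtain ⟨⟨s, r⟩, rfl⟩ := (blockEquiv _).surjective t
    simp only [blockMul_blockEquiv, Function.comp_apply, sumPerm_blockEquiv]

end TupleSystem

end Tuples

/-! ### The simplex operad -/

/-- The data defining `J(n) = Δⁿ⁻¹ / ∂Δⁿ⁻¹`: here `Δⁿ⁻¹` is the standard simplex in barycentric
coordinates, and its boundary consists of the points with some vanishing coordinate. -/
def simplexSystem : TupleSystem ℝ where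
  A n := stdSimplex ℝ (Fin n)
  B n := {t | ∃ i, t i = 0}
  isClosed_A n := isClosed_stdSimplex ℝ (Fin n)
  isClosed_B n := by
    simp only [Set.ofPred_exists]
    exact isClosed_iUnion_of_finite fun i => isClosed_eq (continuous_apply i) continuous_const
  perm_A := by
    intro n x σ hx
    exact ⟨fun i => hx.1 (σ i), (Equiv.sum_comp σ x).trans hx.2⟩
  perm_B := by
    rintro n x σ ⟨i, hi⟩
    exact ⟨σ.symm i, by simpa using hi⟩
  one_A := ⟨fun _ => zero_le_one, Fin.sum_univ_one fun _ => (1 : ℝ)⟩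
  mul_A := by
    intro k n c d hc hd
    refine ⟨fun t => mul_nonneg (hc.1 _) ((hd _).1 _), ?_⟩
    rw [← (blockEquiv n).sum_comp, Fintype.sum_sigma]
    simp only [blockMul_blockEquiv, ← Finset.mul_sum, (hd _).2, mul_one]
    exact hc.2
  mul_B_left := by
    rintro k n c d - - ⟨s, hs⟩
    exact ⟨blockEquiv n ⟨s, 0⟩, by rw [blockMul_blockEquiv, hs, zero_mul]⟩
  mul_B_right := by
    rintro k n c d s - - ⟨r, hr⟩
    exact ⟨blockEquiv n ⟨s, r⟩, by rw [blockMul_blockEquiv, hr, mul_zero]⟩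

/-- The simplex 1-operad `J`, with composition
`[s₁, …, s_k] × [t₁₁, …] × ⋯ × [t_k₁, …] ↦ [s₁ t₁₁, …, s_k t_kₙₖ]`. -/
noncomputable def simplexOperad : OneOperad := simplexSystem.operad

/-! ### The interval operad -/

/-- A closed subinterval `[lo, hi]` of `[0, 1]` with `lo < hi`. -/
@[ext]
structure Subinterval where
  lo : ℝ
  hi : ℝ
  zero_le : 0 ≤ lo
  lt : lo < hi
  le_one : hi ≤ 1

namespace Subinterval

/-- The interval as a set of real numbers. -/
def toSet (J : Subinterval) : Set ℝ := Set.Icc J.lo J.hi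

/-- The increasing affine homeomorphism from `[0, 1]` to the interval. -/
def param (J : Subinterval) (x : ℝ) : ℝ := J.lo + (J.hi - J.lo) * x

theorem param_lt (J : Subinterval) {x y : ℝ} (h : x < y) : J.param x < J.param y := by
  unfold param
  have := J.lt
  nlinarith

theorem param_le (J : Subinterval) {x y : ℝ} (h : x ≤ y) : J.param x ≤ J.param y := by
  rcases h.eq_or_lt with rfl | h
  · exact le_rfl
  · exact (J.param_lt h).le

theorem param_zero (J : Subinterval) : J.param 0 = J.lo := by
  simp [param]

theorem param_one (J : Subinterval) : J.param 1 = J.hi := by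
  simp [param]

/-- The intervals form a monoid: the product of `J` and `K` is the image of `K` under the
increasing affine homeomorphism from `[0, 1]` to `J`. -/
instance : Monoid Subinterval where
  one := ⟨0, 1, le_rfl, zero_lt_one, le_rfl⟩
  mul J K :=
    { lo := J.param K.lo
      hi := J.param K.hi
      zero_le := (J.zero_le.trans_eq J.param_zero.symm).trans (J.param_le K.zero_le)
      lt := J.param_lt K.lt
      le_one := (J.param_le K.le_one).trans (J.param_one.trans_le J.le_one) }
  mul_assoc J K L := by
    ext
    · change (J.param K.lo) + (J.param K.hi - J.param K.lo) * L.lo = J.param (K.param L.lo)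
      unfold param
      ring
    · change (J.param K.lo) + (J.param K.hi - J.param K.lo) * L.hi = J.param (K.param L.hi)
      unfold param
      ring
  one_mul J := by
    ext
    · change 0 + (1 - 0) * J.lo = J.lo
      ring
    · change 0 + (1 - 0) * J.hi = J.hi
      ring
  mul_one J := by
    ext
    · exact J.param_zero
    · exact J.param_one

theorem mul_lo (J K : Subinterval) : (J * K).lo = J.param K.lo := rfl

theorem mul_hi (J K : Subinterval) : (J * K).hi = J.param K.hi := rfl

/-- The end points of an interval. -/
def ends (J : Subinterval) : ℝ × ℝ := (J.lo, J.hi)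

/-- The topology on the set of intervals is induced from `ℝ²`. -/
instance : TopologicalSpace Subinterval := TopologicalSpace.induced ends inferInstance

theorem isInducing_ends : Topology.IsInducing ends := ⟨rfl⟩

theorem isEmbedding_ends : Topology.IsEmbedding ends :=
  ⟨isInducing_ends, fun _ _ h => Subinterval.ext (congrArg Prod.fst h) (congrArg Prod.snd h)⟩

theorem range_ends : Set.range ends = {p : ℝ × ℝ | p.1 < p.2} ∩ {p | 0 ≤ p.1 ∧ p.2 ≤ 1} := by
  ext p
  constructor
  · rintro ⟨J, rfl⟩
    exact ⟨J.lt, J.zero_le, J.le_one⟩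
  · rintro ⟨h1, h2, h3⟩
    exact ⟨⟨p.1, p.2, h2, h1, h3⟩, rfl⟩

theorem continuous_lo : Continuous lo := continuous_fst.comp isInducing_ends.continuous

theorem continuous_hi : Continuous hi := continuous_snd.comp isInducing_ends.continuous

instance : T3Space Subinterval := isEmbedding_ends.t3Space

instance : LocallyCompactSpace Subinterval := by
  refine isInducing_ends.locallyCompactSpace ⟨_, _, ?_, ?_, range_ends⟩
  · exact isOpen_lt continuous_fst continuous_snd
  · exact (isClosed_le continuous_const continuous_fst).inter
      (isClosed_le continuous_snd continuous_const)

instance : ContinuousMul Subinterval where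
  continuous_mul := by
    have h1 : Continuous fun p : Subinterval × Subinterval => p.1.lo :=
      continuous_lo.comp continuous_fst
    have h2 : Continuous fun p : Subinterval × Subinterval => p.1.hi :=
      continuous_hi.comp continuous_fst
    have h3 : Continuous fun p : Subinterval × Subinterval => p.2.lo :=
      continuous_lo.comp continuous_snd
    have h4 : Continuous fun p : Subinterval × Subinterval => p.2.hi :=
      continuous_hi.comp continuous_snd
    rw [isInducing_ends.continuous_iff]
    exact (h1.add ((h2.sub h1).mul h3)).prodMk (h1.add ((h2.sub h1).mul h4))

theorem interior_iInter_eq_empty_iff {n : ℕ} (x : Fin n → Subinterval) :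
    interior (⋂ i, (x i).toSet) = ∅ ↔ ¬ ∃ u : ℝ, ∀ i, (x i).lo < u ∧ u < (x i).hi := by
  rw [interior_iInter_of_finite, Set.eq_empty_iff_forall_notMem, not_exists]
  simp [toSet]

end Subinterval

/-- The data defining `Q(n)`: the space of all `n`-tuples of subintervals `[s, t]` of `[0, 1]` with
`s < t`, and the subspace of those `n`-tuples whose intersection has empty interior. -/
def intervalSystem : TupleSystem Subinterval where
  A _ := Set.univ
  B _ := {x | interior (⋂ i, (x i).toSet) = ∅}
  isClosed_A _ := isClosed_univ
  isClosed_B n := by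
    simp only [Subinterval.interior_iInter_eq_empty_iff]
    rw [← isOpen_compl_iff]
    simp only [Set.compl_ofPred, not_not, Set.ofPred_exists, Set.ofPred_forall]
    refine isOpen_iUnion fun u => isOpen_iInter_of_finite fun i => ?_
    exact (isOpen_lt (Subinterval.continuous_lo.comp (continuous_apply i)) continuous_const).inter
      (isOpen_lt continuous_const (Subinterval.continuous_hi.comp (continuous_apply i)))
  perm_A _ _ := trivial
  perm_B := by
    intro n x σ hx
    have : ⋂ i, (x (σ i)).toSet = ⋂ i, (x i).toSet := σ.surjective.iInter_comp fun i => (x i).toSet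
    exact (congrArg interior this).trans hx
  one_A := trivial
  mul_A _ _ := trivial
  mul_B_left := by
    intro k n c d _ _ hc
    simp only [Set.mem_ofPred_eq, Subinterval.interior_iInter_eq_empty_iff] at hc ⊢
    rintro ⟨u, hu⟩
    refine hc ⟨u, fun s => ?_⟩
    have h := hu (blockEquiv n ⟨s, 0⟩)
    rw [blockMul_blockEquiv, Subinterval.mul_lo, Subinterval.mul_hi] at h
    have h0 := (c s).param_le (d s 0).zero_le
    have h1 := (c s).param_le (d s 0).le_one
    rw [Subinterval.param_zero] at h0
    rw [Subinterval.param_one] at h1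
    exact ⟨h0.trans_lt h.1, h.2.trans_le h1⟩
  mul_B_right := by
    intro k n c d s _ _ hd
    simp only [Set.mem_ofPred_eq, Subinterval.interior_iInter_eq_empty_iff] at hd ⊢
    rintro ⟨u, hu⟩
    have hpos : 0 < (c s).hi - (c s).lo := sub_pos.2 (c s).lt
    refine hd ⟨(u - (c s).lo) / ((c s).hi - (c s).lo), fun r => ?_⟩
    have h := hu (blockEquiv n ⟨s, r⟩)
    rw [blockMul_blockEquiv, Subinterval.mul_lo, Subinterval.mul_hi] at h
    unfold Subinterval.param at h
    rw [lt_div_iff₀ hpos, div_lt_iff₀ hpos]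
    constructor <;> linarith [h.1, h.2]

/-- The interval 1-operad `Q`: the composition of `(J₁, …, J_k)` with the tuples
`(K_s₁, …, K_sₙₛ)` consists of the images of the `K_sr` under the increasing affine homeomorphisms
from `[0, 1]` to `J_s`. -/
noncomputable def intervalOperad : OneOperad := intervalSystem.operad

/-! Five operads occur, all of the form "tuples in a topological monoid modulo a closed set of
degenerate tuples" (`TupleSystem`). A continuous multiplicative map that respects the tuples
therefore gives a morphism of operads (`TupleSystem.Hom.operadHom`), and four such maps form the
zigzag Q → E ← M → F ← J. Here F (`fatSimplexSystem`) and M (`maxSimplexSystem`) consist of tuples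
in the unit cube, with sum at least 1 and with maximum 1 respectively, and E (`expSystem`) consists
of tuples of intervals in `[0, ∞]`.

The bridge is E. Intervals of length 1 compose by adding their left ends, so in the parameter t =
exp(-a) they compose by multiplication, as barycentric coordinates do; the coordinate t = 0 is an
interval at infinity. Subintervals of `[0, 1]` compose by the same affine rule, so they lie in the
same monoid. Some interval of each tuple in E is required to lie in `[0, 1]`; this condition is
preserved by composition, and it is what makes composites of degenerate tuples degenerate.

It remains to find homotopy inverses in each arity, and these need not be multiplicative. Dividing
by the sum or by the maximum retracts F onto J or M, and straight lines stay in F because it is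
convex. In E, all lengths are shrunk to the minimal length m, the smallest left end is moved to 0,
and left ends are truncated at m. A degenerate tuple then has one interval starting at 0 and another
starting exactly at m (`exists_relPos_eq_exp`). All intervals now lie in `[0, 2]`, so halving gives
an inverse of Q → E (`isEquivalence_intervalInclusion`). Replacing a left end a by 1 - a/m instead
gives a point of M, hence an inverse of M → E (`isEquivalence_maxSimplexToExp`).

The passage from homotopies of pairs to weak equivalences is `Collapse.map_homotopic` together with
`isWeakHomotopyEquiv_of_homotopic`. The latter must treat free homotopies, since weak equivalence is
tested at every base point. -/

/-! ### Homotopy equivalences are weak homotopy equivalences -/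

section CubeCollar

open scoped unitInterval

variable {N : Type}

/-! ### Radial coordinates on the cube. -/

/-- The distance of a point of the cube from the centre, for the supremum norm. -/
noncomputable def cubeRadius [Fintype N] (y : N → I) : ℝ := ‖fun i => (y i : ℝ) - 1 / 2‖

/-- The expansion of the cube from its centre by the factor `k`, followed by the retraction of
the ambient space onto the cube. -/
noncomputable def cubeZoom (k : ℝ) (y : N → I) : N → I :=
  fun i => Set.projIcc 0 1 zero_le_one (k * ((y i : ℝ) - 1 / 2) + 1 / 2)

theorem cubeRadius_le [Fintype N] (y : N → I) : cubeRadius y ≤ 1 / 2 := by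
  refine (pi_norm_le_iff_of_nonneg (by norm_num)).2 fun i => ?_
  rw [Real.norm_eq_abs, abs_le]
  constructor <;> linarith [(y i).2.1, (y i).2.2]

theorem cubeRadius_of_mem_boundary [Fintype N] {y : N → I} (hy : y ∈ Cube.boundary N) :
    cubeRadius y = 1 / 2 := by
  refine (cubeRadius_le y).antisymm ?_
  obtain ⟨i, hi⟩ := hy
  refine le_trans ?_ (norm_le_pi_norm (fun i => (y i : ℝ) - 1 / 2) i)
  rcases hi with hi | hi <;> simp only [hi, Real.norm_eq_abs] <;> norm_num [abs_of_pos]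

theorem cubeZoom_one (y : N → I) : cubeZoom 1 y = y := by
  funext i
  refine Eq.trans ?_ (Set.projIcc_val zero_le_one (y i))
  simp [cubeZoom]

/-- If no coordinate is clamped to 0 or 1, every |k(yᵢ - 1/2)| is less than 1/2, hence so is k times
the radius. -/
theorem cubeZoom_mem_boundary [Fintype N] {k : ℝ} (hk : 0 ≤ k) {y : N → I}
    (h : 1 / 2 ≤ k * cubeRadius y) : cubeZoom k y ∈ Cube.boundary N := by
  by_contra hy
  refine h.not_gt ?_
  have h1 : k * cubeRadius y = ‖k • fun i => (y i : ℝ) - 1 / 2‖ := by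
    rw [norm_smul, Real.norm_of_nonneg hk]
    rfl
  rw [h1, pi_norm_lt_iff (by norm_num)]
  intro i
  have hi : ¬ (cubeZoom k y i = 0 ∨ cubeZoom k y i = 1) := fun hi => hy ⟨i, hi⟩
  rw [not_or] at hi
  rw [Pi.smul_apply, smul_eq_mul, Real.norm_eq_abs, abs_lt]
  constructor
  · by_contra h2
    exact hi.1 (Set.projIcc_of_le_left _ (by linarith))
  · by_contra h2
    exact hi.2 (Set.projIcc_of_right_le _ (by linarith))

theorem continuous_cubeRadius [Fintype N] : Continuous (cubeRadius : (N → I) → ℝ) := by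
  unfold cubeRadius
  fun_prop

theorem continuous_cubeZoom : Continuous fun q : ℝ × (N → I) => cubeZoom q.1 q.2 := by
  refine continuous_pi fun i => continuous_projIcc.comp ?_
  fun_prop

/-! ### Attaching a collar to a map on the cube. -/

variable {X : Type}

open Classical in
/-- The map on the cube that is a copy of `p` on the cube scaled by `1 / k`, and follows the path
`γ` on the radii of the remaining collar. -/
noncomputable def cubeGlue [Fintype N] (k : ℝ) (p : (N → I) → X) (γ : ℝ → X) (y : N → I) : X :=
  if k * cubeRadius y ≤ 1 / 2 then p (cubeZoom k y) else γ (2 * (k * cubeRadius y) - 1)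

theorem cubeGlue_one [Fintype N] (p : (N → I) → X) (γ : ℝ → X) (y : N → I) : cubeGlue 1 p γ y = p y := by
  unfold cubeGlue
  rw [if_pos (by linarith [cubeRadius_le y]), cubeZoom_one]

theorem cubeGlue_of_mem_boundary [Fintype N] {k : ℝ} (hk : 1 ≤ k) {p : (N → I) → X} {γ : ℝ → X}
    (h : ∀ y ∈ Cube.boundary N, p y = γ 0) {y : N → I} (hy : y ∈ Cube.boundary N) :
    cubeGlue k p γ y = γ (k - 1) := by
  have hr := cubeRadius_of_mem_boundary hy
  unfold cubeGlue
  split_ifs with h1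
  -- The radius is 1/2 on the boundary, so the inner branch is reached there only if there is no
  -- collar.
  · obtain rfl : k = 1 := by
      rw [hr] at h1
      linarith
    rw [cubeZoom_one, h y hy, sub_self]
  · rw [hr]
    congr 1
    ring

variable [TopologicalSpace X]

/-- The branches meet where the zoomed point is on the boundary of the cube, and there `p` takes the
initial value of the path. The parameter space `S` is the time of a homotopy, or a point for a
single map. -/
theorem continuous_cubeGlue [Fintype N] {S : Type} [TopologicalSpace S] {k : S → ℝ} (hk : Continuous k)
    (hk0 : ∀ s, 0 ≤ k s) {p : S → (N → I) → X} (hp : Continuous fun q : S × (N → I) => p q.1 q.2)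
    {γ : S → ℝ → X} (hγ : Continuous fun q : S × ℝ => γ q.1 q.2)
    (h : ∀ s, ∀ y ∈ Cube.boundary N, p s y = γ s 0) :
    Continuous fun q : S × (N → I) => cubeGlue (k q.1) (p q.1) (γ q.1) q.2 := by
  have hr : Continuous fun q : S × (N → I) => k q.1 * cubeRadius q.2 :=
    (hk.comp continuous_fst).mul (continuous_cubeRadius.comp continuous_snd)
  unfold cubeGlue
  refine Continuous.if_le ?_ ?_ hr continuous_const ?_
  · exact hp.comp (continuous_fst.prodMk (continuous_cubeZoom.comp
      ((hk.comp continuous_fst).prodMk continuous_snd)))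
  · exact hγ.comp (continuous_fst.prodMk ((continuous_const.mul hr).sub continuous_const))
  · intro q hq
    rw [h q.1 _ (cubeZoom_mem_boundary (hk0 _) hq.ge), hq]
    norm_num

/-! ### Homotopies along a path and change of base point. -/

/-- The maps `p` and `q` on the cube are connected by a homotopy which at every time is constant
on the boundary of the cube, with value given by the path `γ`. -/
def HomotopicAlong (γ : C(I, X)) (p q : C(N → I, X)) : Prop :=
  ∃ F : C(I × (N → I), X), (∀ y, F (0, y) = p y) ∧ (∀ y, F (1, y) = q y) ∧
    ∀ s, ∀ y ∈ Cube.boundary N, F (s, y) = γ s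

theorem HomotopicAlong.symm {γ : C(I, X)} {p q : C(N → I, X)} (h : HomotopicAlong γ p q) :
    HomotopicAlong (γ.comp ⟨σ, unitInterval.continuous_symm⟩) q p := by
  obtain ⟨F, h0, h1, hF⟩ := h
  refine ⟨F.comp ⟨fun z => (σ z.1, z.2), by fun_prop⟩, fun y => ?_, fun y => ?_,
    fun s y hy => hF _ y hy⟩
  · simpa using h1 y
  · simpa using h0 y

/-- This is homotopy extension from the boundary: at time s the collar has scale 1 + s and carries
the part of `γ` over [0, s], so the boundary value is γ(s). -/
theorem exists_homotopicAlong [Fintype N] (γ : C(I, X)) {p : C(N → I, X)}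
    (hp : ∀ y ∈ Cube.boundary N, p y = γ 0) :
    ∃ q : C(N → I, X), HomotopicAlong γ p q := by
  let F : C(I × (N → I), X) :=
    ⟨fun z => cubeGlue (1 + (z.1 : ℝ)) p (fun e => γ (Set.projIcc 0 1 zero_le_one e)) z.2, by
      refine continuous_cubeGlue (S := I) (k := fun s => 1 + (s : ℝ)) (p := fun _ => p)
        (γ := fun _ e => γ (Set.projIcc 0 1 zero_le_one e)) (by fun_prop)
        (fun s => by linarith [s.2.1]) (by fun_prop) ?_ ?_
      · exact γ.continuous.comp (continuous_projIcc.comp continuous_snd)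
      · intro s y hy
        simpa using hp y hy⟩
  have hF : ∀ z, F z =
      cubeGlue (1 + (z.1 : ℝ)) p (fun e => γ (Set.projIcc 0 1 zero_le_one e)) z.2 := fun _ => rfl
  refine ⟨⟨fun y => F (1, y), by fun_prop⟩, F, fun y => ?_, fun y => rfl, fun s y hy => ?_⟩
  · rw [hF, Set.Icc.coe_zero, add_zero, cubeGlue_one]
  · rw [hF, cubeGlue_of_mem_boundary (by linarith [s.2.1]) (fun y hy => by simpa using hp y hy) hy]
    simp

/-- Put the loop `q` at the end of the path `γ` into the centre of the cube, and the reversed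
path on the collar. -/
noncomputable def cubeTransport [Fintype N] (γ : C(I, X)) (q : C(N → I, X))
    (hq : ∀ y ∈ Cube.boundary N, q y = γ 1) : C(N → I, X) :=
  ⟨cubeGlue 2 q (fun e => γ (Set.projIcc 0 1 zero_le_one (1 - e))), by
    refine (continuous_cubeGlue (S := Unit) (k := fun _ => 2) (p := fun _ => q)
      (γ := fun _ e => γ (Set.projIcc 0 1 zero_le_one (1 - e))) (by fun_prop)
      (fun s => zero_le_two) (by fun_prop) ?_ ?_).comp (Continuous.prodMk_right ())
    · exact γ.continuous.comp (continuous_projIcc.comp (by fun_prop))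
    · intro s y hy
      simpa using hq y hy⟩

theorem HomotopicAlong.apply_one {γ : C(I, X)} {p q : C(N → I, X)} (h : HomotopicAlong γ p q) :
    ∀ y ∈ Cube.boundary N, q y = γ 1 := by
  obtain ⟨F, -, h1, hF⟩ := h
  exact fun y hy => (h1 y).symm.trans (hF 1 y hy)

theorem HomotopicAlong.homotopicRel [Fintype N] {γ : C(I, X)} {p q : C(N → I, X)}
    (h : HomotopicAlong γ p q) :
    p.HomotopicRel (cubeTransport γ q h.apply_one) (Cube.boundary N) := by
  have hq := h.apply_one
  obtain ⟨F, h0, h1, hF⟩ := h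
  have hb : ∀ s : I, ∀ y ∈ Cube.boundary N,
      F (s, y) = γ (Set.projIcc 0 1 zero_le_one ((s : ℝ) - 0)) := by
    intro s y hy
    rw [hF s y hy, sub_zero, Set.projIcc_val]
  -- At time s the centre carries F(s, ·), and the collar runs back along `γ` from γ(s) to γ(0); the
  -- boundary value is thus γ(0) at all times.
  refine ⟨⟨⟨⟨fun z => cubeGlue (1 + (z.1 : ℝ)) (fun y => F (z.1, y))
    (fun e => γ (Set.projIcc 0 1 zero_le_one ((z.1 : ℝ) - e))) z.2, ?_⟩, ?_, ?_⟩, ?_⟩⟩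
  · refine continuous_cubeGlue (S := I) (k := fun s => 1 + (s : ℝ)) (p := fun s y => F (s, y))
      (γ := fun s e => γ (Set.projIcc 0 1 zero_le_one ((s : ℝ) - e))) (by fun_prop)
      (fun s => by linarith [s.2.1]) (by fun_prop) ?_ hb
    exact γ.continuous.comp (continuous_projIcc.comp (by fun_prop))
  · intro y
    simp only [Set.Icc.coe_zero, add_zero]
    rw [cubeGlue_one, h0]
  · intro y
    simp only [Set.Icc.coe_one, h1]
    rw [one_add_one_eq_two]
    rfl
  · intro s y hy
    refine (cubeGlue_of_mem_boundary (p := fun y => F (s, y))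
      (γ := fun e => γ (Set.projIcc 0 1 zero_le_one ((s : ℝ) - e)))
      (by linarith [s.2.1]) (hb s) hy).trans ?_
    rw [← h0, hF 0 y hy]
    refine congrArg γ (Set.projIcc_of_le_left _ ?_)
    linarith

theorem cubeTransport_homotopicRel [Fintype N] {γ : C(I, X)} {q q' : C(N → I, X)}
    (hq : ∀ y ∈ Cube.boundary N, q y = γ 1) (hq' : ∀ y ∈ Cube.boundary N, q' y = γ 1)
    (h : q.HomotopicRel q' (Cube.boundary N)) :
    (cubeTransport γ q hq).HomotopicRel (cubeTransport γ q' hq') (Cube.boundary N) := by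
  obtain ⟨G⟩ := h
  have hb : ∀ s : I, ∀ y ∈ Cube.boundary N,
      G (s, y) = γ (Set.projIcc 0 1 zero_le_one (1 - 0)) := by
    intro s y hy
    rw [G.eq_fst s hy, hq y hy]
    simp
  refine ⟨⟨⟨⟨fun z => cubeGlue 2 (fun y => G (z.1, y))
    (fun e => γ (Set.projIcc 0 1 zero_le_one (1 - e))) z.2, ?_⟩, ?_, ?_⟩, ?_⟩⟩
  · refine continuous_cubeGlue (S := I) (k := fun s => 2) (p := fun s y => G (s, y))
      (γ := fun s e => γ (Set.projIcc 0 1 zero_le_one (1 - e))) (by fun_prop)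
      (fun s => zero_le_two) ?_ ?_ hb
    · exact G.continuous.comp (continuous_fst.prodMk continuous_snd)
    · exact γ.continuous.comp (continuous_projIcc.comp (by fun_prop))
  · intro y
    simp only [G.apply_zero]
    rfl
  · intro y
    simp only [G.apply_one]
    rfl
  · intro s y hy
    let δ : ℝ → X := fun e => γ (Set.projIcc 0 1 zero_le_one (1 - e))
    exact (cubeGlue_of_mem_boundary (p := fun y => G (s, y)) (γ := δ) one_le_two (hb s) hy).trans
      (cubeGlue_of_mem_boundary (p := q) (γ := δ) one_le_two
        (fun y hy => by simpa [δ] using hq y hy) hy).symm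

/-- Relative to the boundary, `p` and `p'` are the transports of `q` and `q'` along the same path,
and transport respects relative homotopy. -/
theorem HomotopicAlong.homotopicRel_of_homotopicRel [Fintype N] {γ : C(I, X)} {p p' q q' : C(N → I, X)}
    (h : HomotopicAlong γ p q) (h' : HomotopicAlong γ p' q')
    (hq : q.HomotopicRel q' (Cube.boundary N)) : p.HomotopicRel p' (Cube.boundary N) :=
  h.homotopicRel.trans ((cubeTransport_homotopicRel _ _ hq).trans h'.homotopicRel.symm)

end CubeCollar

theorem homotopyGroupMap_comp {X Y Z : Type} [TopologicalSpace X] [TopologicalSpace Y]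
    [TopologicalSpace Z] (g : C(Y, Z)) (f : C(X, Y)) (n : ℕ) (x : X) :
    homotopyGroupMap (g.comp f) n x = homotopyGroupMap g n (f x) ∘ homotopyGroupMap f n x := by
  funext z
  induction z using Quotient.inductionOn
  rfl

/-- A map that is freely homotopic to the identity induces bijections of homotopy groups. -/
theorem bijective_homotopyGroupMap_of_homotopic_id {X : Type} [TopologicalSpace X] {h : C(X, X)}
    (H : (ContinuousMap.id X).Homotopic h) (n : ℕ) (x : X) :
    Function.Bijective (homotopyGroupMap h n x) := by
  obtain ⟨H⟩ := H
  let γ : C(unitInterval, X) := ⟨fun s => H (s, x), by fun_prop⟩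
  have key : ∀ p : GenLoop (Fin n) X x, HomotopicAlong γ p.1 (h.comp p.1) := by
    intro p
    refine ⟨⟨fun z => H (z.1, p z.2), by fun_prop⟩, fun y => H.apply_zero _,
      fun y => H.apply_one _, fun s y hy => ?_⟩
    exact congrArg (fun z => H (s, z)) (p.2 y hy)
  constructor
  · intro a b
    induction a using Quotient.inductionOn with | h p => ?_
    induction b using Quotient.inductionOn with | h q => ?_
    intro hpq
    exact Quotient.sound ((key p).homotopicRel_of_homotopicRel (key q) (Quotient.exact hpq))
  · intro b
    induction b using Quotient.inductionOn with | h q => ?_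
    have hγ1 : γ 1 = h x := H.apply_one x
    have hγ0 : γ 0 = x := H.apply_zero x
    -- A preimage of the class of `q` is found by dragging `q` back along the reversed trace of the
    -- base point. Then `q` and `h.comp p` are both homotopic to `p` along that reversed path.
    obtain ⟨p, hp⟩ := exists_homotopicAlong
      (γ.comp ⟨unitInterval.symm, unitInterval.continuous_symm⟩) (p := q.1) (by
        intro y hy
        simpa [hγ1] using q.2 y hy)
    have hpx : ∀ y ∈ Cube.boundary (Fin n), p y = x := by
      intro y hy
      simpa [hγ0] using hp.apply_one y hy
    refine ⟨Quotient.mk _ ⟨p, hpx⟩, Quotient.sound ?_⟩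
    exact (key ⟨p, hpx⟩).symm.homotopicRel_of_homotopicRel hp
      (ContinuousMap.HomotopicRel.refl _)

theorem isWeakHomotopyEquiv_of_homotopic {X Y : Type} [TopologicalSpace X] [TopologicalSpace Y]
    (f : C(X, Y)) (g : C(Y, X)) (hgf : (ContinuousMap.id X).Homotopic (g.comp f))
    (hfg : (ContinuousMap.id Y).Homotopic (f.comp g)) : IsWeakHomotopyEquiv f := by
  intro n x
  have h1 := bijective_homotopyGroupMap_of_homotopic_id hgf n x
  have h2 := bijective_homotopyGroupMap_of_homotopic_id hfg n (f x)
  rw [homotopyGroupMap_comp] at h1 h2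
  -- In f∗ ∘ g∗ ∘ f∗ both adjacent composites are bijective, so the middle map is bijective, and
  -- then so is the first.
  have h3 : Function.Bijective (homotopyGroupMap g n (f x)) :=
    ⟨h2.1.of_comp, h1.2.of_comp⟩
  exact (Function.Bijective.of_comp_iff' h3 _).1 h1

/-! ### Maps of pairs and maps of quotients -/

namespace Collapse

variable {X Y Z : Type} {B : Set X} {B' : Set Y} {B'' : Set Z}
  [TopologicalSpace X] [TopologicalSpace Y] [TopologicalSpace Z]

/-- The map of quotients induced by a map of pairs. -/
def map (f : C(X, Y)) (h : Set.MapsTo f B B') : C(Collapse B, Collapse B') where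
  toFun := Quotient.lift (s := collapseSetoid B) (fun x => proj B' (Sum.map f id x)) (by
    have key : ∀ x ∈ baseSet B, proj B' (Sum.map f id x) = pt B' := by
      rintro x (⟨y, hy, rfl⟩ | ⟨u, rfl⟩)
      · exact mk_eq_pt_iff.2 (h hy)
      · rfl
    rintro x y (rfl | hxy)
    · rfl
    · exact (key x hxy.1).trans (key y hxy.2).symm)
  continuous_toFun := Continuous.quotient_lift
    (isQuotientMap_proj.continuous.comp (f.continuous.sumMap continuous_id)) _

theorem map_comp_map (g : C(Y, Z)) (hg : Set.MapsTo g B' B'') (f : C(X, Y))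
    (hf : Set.MapsTo f B B') : (map g hg).comp (map f hf) = map (g.comp f) (hg.comp hf) := by
  ext z
  rcases eq_pt_or_eq_mk z with rfl | ⟨x, rfl⟩
  · rfl
  · rfl

theorem map_id : map (ContinuousMap.id X) (Set.mapsTo_id B) = ContinuousMap.id (Collapse B) := by
  ext z
  rcases eq_pt_or_eq_mk z with rfl | ⟨x, rfl⟩
  · rfl
  · rfl

/-- A homotopy of pairs descends because the unit interval is locally compact: its product with a
quotient map is again a quotient map. -/
theorem map_homotopic {f g : C(X, Y)} (hf : Set.MapsTo f B B') (hg : Set.MapsTo g B B')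
    (H : C(unitInterval × X, Y)) (h0 : ∀ x, H (0, x) = f x) (h1 : ∀ x, H (1, x) = g x)
    (hB : ∀ s, ∀ x ∈ B, H (s, x) ∈ B') : (map f hf).Homotopic (map g hg) := by
  let K : ∀ s : unitInterval, C(Collapse B, Collapse B') := fun s =>
    map ⟨fun x => H (s, x), by fun_prop⟩ (hB s)
  refine ⟨⟨⟨fun z => K z.1 z.2, ?_⟩, fun z => ?_, fun z => ?_⟩⟩
  · refine isQuotientMap_proj.continuous_lift_prod_right (g := fun z => K z.1 z.2) ?_
    have h : Continuous fun p : unitInterval × (X ⊕ Unit) =>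
        Sum.elim (fun x s => mk B' (H (s, x))) (fun _ _ => pt B') p.2 p.1 := by
      rw [← (Homeomorph.prodSumDistrib (X := unitInterval) (Y := X)
        (Z := Unit)).symm.comp_continuous_iff']
      refine continuous_sum_dom.2 ⟨?_, ?_⟩
      · exact (isQuotientMap_proj.continuous.comp continuous_inl).comp H.continuous
      · exact continuous_const
    refine h.congr ?_
    rintro ⟨s, x | u⟩
    · rfl
    · rfl
  · rcases eq_pt_or_eq_mk z with rfl | ⟨x, rfl⟩
    · rfl
    · exact congrArg (mk B') (h0 x)
  · rcases eq_pt_or_eq_mk z with rfl | ⟨x, rfl⟩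
    · rfl
    · exact congrArg (mk B') (h1 x)

/-- A homotopy equivalence of pairs induces a weak equivalence of quotients. -/
theorem isWeakHomotopyEquiv_map (f : C(X, Y)) (hf : Set.MapsTo f B B')
    (g : C(Y, X)) (hg : Set.MapsTo g B' B)
    (h1 : (map (ContinuousMap.id X) (Set.mapsTo_id B)).Homotopic (map (g.comp f) (hg.comp hf)))
    (h2 : (map (ContinuousMap.id Y) (Set.mapsTo_id B')).Homotopic
      (map (f.comp g) (hf.comp hg))) : IsWeakHomotopyEquiv (map f hf) := by
  rw [map_id, ← map_comp_map g hg f hf] at h1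
  rw [map_id, ← map_comp_map f hf g hg] at h2
  exact isWeakHomotopyEquiv_of_homotopic _ _ h1 h2

end Collapse

/-! ### Morphisms of tuple systems -/

namespace TupleSystem

variable {M N : Type} [Monoid M] [TopologicalSpace M] [Monoid N] [TopologicalSpace N]

/-- A map between monoids that is multiplicative and continuous on the coordinates of the tuples
in `S`, and that sends tuples in `S` to tuples in `T`. -/
structure Hom (S : TupleSystem M) (T : TupleSystem N) where
  toFun : M → N
  -- A domain is needed because `unitExpInterval` clamps its argument and is multiplicative only on
  -- [0, 1].
  domain : Set M
  mem_domain : ∀ {n : ℕ+} {x : Fin n → M}, x ∈ S.A n → ∀ i, x i ∈ domain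
  continuousOn : ContinuousOn toFun domain
  map_one : toFun 1 = 1
  map_mul : ∀ {x y : M}, x ∈ domain → y ∈ domain → toFun (x * y) = toFun x * toFun y
  map_A : ∀ {n : ℕ+} {x : Fin n → M}, x ∈ S.A n → toFun ∘ x ∈ T.A n
  map_B : ∀ {n : ℕ+} {x : Fin n → M}, x ∈ S.A n → x ∈ S.B n → toFun ∘ x ∈ T.B n

namespace Hom

variable {S : TupleSystem M} {T : TupleSystem N} (φ : Hom S T)

/-- The map of spaces of tuples. -/
def tupleMap (n : ℕ+) : C(S.A n, T.A n) where
  toFun x := ⟨φ.toFun ∘ x.1, φ.map_A x.2⟩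
  continuous_toFun := by
    refine Continuous.subtype_mk (continuous_pi fun i => ?_) _
    exact φ.continuousOn.comp_continuous ((continuous_apply i).comp continuous_subtype_val)
      fun x => φ.mem_domain x.2 i

theorem mapsTo_tupleMap (n : ℕ+) : Set.MapsTo (φ.tupleMap n) (S.base n) (T.base n) :=
  fun x hx => φ.map_B x.2 hx

variable [LocallyCompactSpace M] [T3Space M] [LocallyCompactSpace N] [T3Space N]

/-- The map of quotients. -/
noncomputable def spaceMap (n : ℕ+) : C(S.space n, T.space n) :=
  Collapse.map (φ.tupleMap n) (φ.mapsTo_tupleMap n)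

theorem spaceMap_pt (n : ℕ+) : φ.spaceMap n (S.space n).pt = (T.space n).pt := rfl

theorem spaceMap_γ {k : ℕ+} {n : Fin k → ℕ+} (c : S.space k) (d : ∀ s, S.space (n s)) :
    φ.spaceMap (total n) (S.operadData.γ c d) =
      T.operadData.γ (φ.spaceMap k c) fun s => φ.spaceMap (n s) (d s) := by
  rcases S.space_cases c with rfl | ⟨c, rfl⟩
  · exact (congrArg (φ.spaceMap _) (S.γ_pt_left d)).trans (T.γ_pt_left _).symm
  rcases S.exists_cls d with ⟨s, hs⟩ | ⟨d, rfl⟩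
  · exact (congrArg (φ.spaceMap _) (S.γ_pt_right _ d s hs)).trans
      (T.γ_pt_right _ _ s (congrArg (φ.spaceMap _) hs)).symm
  refine (congrArg (φ.spaceMap _) (S.γ_cls c d)).trans ?_
  refine Eq.trans ?_ (T.γ_cls (φ.tupleMap k c) fun s => φ.tupleMap (n s) (d s)).symm
  refine congrArg T.cls (Subtype.ext (funext fun t => ?_))
  exact φ.map_mul (φ.mem_domain c.2 _) (φ.mem_domain (d _).2 _)

/-- The induced morphism of 1-operads. -/
noncomputable def operadHom [ContinuousMul M] [ContinuousMul N] :
    OneOperadHom S.operad T.operad where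
  map := φ.spaceMap
  map_pt := φ.spaceMap_pt
  map_act := by
    intro n x σ
    rcases S.space_cases x with rfl | ⟨x, rfl⟩
    · rfl
    · rfl
  map_unit := congrArg T.cls (Subtype.ext (funext fun _ => φ.map_one))
  map_comp := φ.spaceMap_γ

end Hom

end TupleSystem

/-! ### Rescaled simplices -/

theorem isClosed_cube (n : ℕ) : IsClosed {t : Fin n → ℝ | ∀ i, 0 ≤ t i ∧ t i ≤ 1} := by
  simp only [Set.ofPred_forall]
  exact isClosed_iInter fun i => (isClosed_le continuous_const (continuous_apply i)).inter
    (isClosed_le (continuous_apply i) continuous_const)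

/-- The tuples in the unit cube with coordinate sum at least `1`, modulo those with some vanishing
coordinate. -/
def fatSimplexSystem : TupleSystem ℝ where
  A n := {t | (∀ i, 0 ≤ t i ∧ t i ≤ 1) ∧ 1 ≤ ∑ i, t i}
  B n := {t | ∃ i, t i = 0}
  isClosed_A n := by
    have h : Continuous fun t : Fin n → ℝ => ∑ i, t i := by fun_prop
    exact (isClosed_cube n).inter (isClosed_le continuous_const h)
  isClosed_B := simplexSystem.isClosed_B
  perm_A := by
    intro n x σ hx
    exact ⟨fun i => hx.1 (σ i), hx.2.trans_eq (Equiv.sum_comp σ x).symm⟩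
  perm_B := simplexSystem.perm_B
  one_A := ⟨fun _ => ⟨zero_le_one, le_rfl⟩, (Fin.sum_univ_one fun _ => (1 : ℝ)).ge⟩
  mul_A := by
    intro k n c d hc hd
    refine ⟨fun t => ⟨mul_nonneg (hc.1 _).1 ((hd _).1 _).1,
      mul_le_one₀ (hc.1 _).2 ((hd _).1 _).1 ((hd _).1 _).2⟩, ?_⟩
    rw [← (blockEquiv n).sum_comp, Fintype.sum_sigma]
    simp only [blockMul_blockEquiv, ← Finset.mul_sum]
    -- The `s`-th block sums to `c s` times a number that is at least 1.
    exact hc.2.trans (Finset.sum_le_sum fun s _ => le_mul_of_one_le_right (hc.1 s).1 (hd s).2)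
  mul_B_left := by
    rintro k n c d - - ⟨s, hs⟩
    exact ⟨blockEquiv n ⟨s, 0⟩, by rw [blockMul_blockEquiv, hs, zero_mul]⟩
  mul_B_right := by
    rintro k n c d s - - ⟨r, hr⟩
    exact ⟨blockEquiv n ⟨s, r⟩, by rw [blockMul_blockEquiv, hr, mul_zero]⟩

/-- The tuples in the unit cube with maximal coordinate `1`, modulo those with some vanishing
coordinate. -/
def maxSimplexSystem : TupleSystem ℝ where
  A n := {t | (∀ i, 0 ≤ t i ∧ t i ≤ 1) ∧ ∃ i, t i = 1}
  B n := {t | ∃ i, t i = 0}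
  isClosed_A n := by
    have h : IsClosed {t : Fin n → ℝ | ∃ i, t i = 1} := by
      simp only [Set.ofPred_exists]
      exact isClosed_iUnion_of_finite fun i => isClosed_eq (continuous_apply i) continuous_const
    exact (isClosed_cube n).inter h
  isClosed_B := simplexSystem.isClosed_B
  perm_A := by
    rintro n x σ ⟨hx, i, hi⟩
    exact ⟨fun i => hx (σ i), σ.symm i, by simpa using hi⟩
  perm_B := simplexSystem.perm_B
  one_A := ⟨fun _ => ⟨zero_le_one, le_rfl⟩, 0, rfl⟩
  mul_A := by
    rintro k n c d ⟨hc, s, hs⟩ hd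
    refine ⟨fun t => ⟨mul_nonneg (hc _).1 ((hd _).1 _).1,
      mul_le_one₀ (hc _).2 ((hd _).1 _).1 ((hd _).1 _).2⟩, ?_⟩
    obtain ⟨r, hr⟩ := (hd s).2
    exact ⟨blockEquiv n ⟨s, r⟩, by rw [blockMul_blockEquiv, hs, hr, mul_one]⟩
  mul_B_left := by
    rintro k n c d - - ⟨s, hs⟩
    exact ⟨blockEquiv n ⟨s, 0⟩, by rw [blockMul_blockEquiv, hs, zero_mul]⟩
  mul_B_right := by
    rintro k n c d s - - ⟨r, hr⟩
    exact ⟨blockEquiv n ⟨s, r⟩, by rw [blockMul_blockEquiv, hr, mul_zero]⟩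

/-- The inclusion of the simplices. -/
def simplexInclusion : TupleSystem.Hom simplexSystem fatSimplexSystem where
  toFun := id
  domain := Set.univ
  mem_domain _ _ := trivial
  continuousOn := continuousOn_id
  map_one := rfl
  map_mul _ _ := rfl
  map_A hx := ⟨fun i => ⟨hx.1 i,
    (Finset.single_le_sum (fun j _ => hx.1 j) (Finset.mem_univ i)).trans_eq hx.2⟩, hx.2.ge⟩
  map_B _ hx := hx

/-- The inclusion of the tuples with maximal coordinate `1`. -/
def maxSimplexInclusion : TupleSystem.Hom maxSimplexSystem fatSimplexSystem where
  toFun := id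
  domain := Set.univ
  mem_domain _ _ := trivial
  continuousOn := continuousOn_id
  map_one := rfl
  map_mul _ _ := rfl
  map_A := by
    rintro n x ⟨hx, i, hi⟩
    exact ⟨hx, hi.ge.trans (Finset.single_le_sum (fun j _ => (hx j).1) (Finset.mem_univ i))⟩
  map_B _ hx := hx

/-- If the tuples of `S` are among those of the fat simplices, with the same base, then a
continuous rescaling of the tuples in the fat simplices, fixing the tuples of `S`, makes the
inclusion an equivalence. -/
theorem isWeakHomotopyEquiv_of_rescale {S : TupleSystem ℝ}
    (φ : TupleSystem.Hom S fatSimplexSystem) (hφ : φ.toFun = id) {n : ℕ+}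
    (hB : fatSimplexSystem.B n ⊆ S.B n)
    (a : (Fin n → ℝ) → ℝ) (ha : ContinuousOn a (fatSimplexSystem.A n))
    (haS : ∀ x ∈ fatSimplexSystem.A n, (fun i => a x * x i) ∈ S.A n)
    (haid : ∀ x ∈ S.A n, a x = 1) : IsWeakHomotopyEquiv (φ.spaceMap n) := by
  have hsub : S.A n ⊆ fatSimplexSystem.A n := by
    intro x hx
    have := φ.map_A hx
    rwa [hφ] at this
  have hac : Continuous fun x : fatSimplexSystem.A n => a x.1 :=
    continuousOn_iff_continuous_domRestrict.1 ha
  let g : C(fatSimplexSystem.A n, S.A n) := ⟨fun x => ⟨fun i => a x.1 * x.1 i, haS _ x.2⟩, by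
    refine Continuous.subtype_mk (continuous_pi fun i => ?_) _
    exact hac.mul ((continuous_apply i).comp continuous_subtype_val)⟩
  have hg : Set.MapsTo g (fatSimplexSystem.base n) (S.base n) := by
    rintro x ⟨i, hi⟩
    exact hB ⟨i, by simp [g, hi]⟩
  refine Collapse.isWeakHomotopyEquiv_map (φ.tupleMap n) (φ.mapsTo_tupleMap n) g hg ?_ ?_
  · have : g.comp (φ.tupleMap n) = ContinuousMap.id _ := by
      ext x i
      simp [g, TupleSystem.Hom.tupleMap, hφ, haid _ x.2]
    simp only [this]
    exact ContinuousMap.Homotopic.refl _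
  -- The unit cube and the half-space of sum at least 1 are convex, and a coordinate that vanishes
  -- continues to vanish after rescaling. The straight line from the identity to the rescaling is
  -- therefore a homotopy of pairs.
  · have hmem : ∀ (s : unitInterval) (x : fatSimplexSystem.A n),
        (fun i => (1 - (s : ℝ)) * x.1 i + s * (a x.1 * x.1 i)) ∈ fatSimplexSystem.A n := by
      intro s x
      have h1 := x.2
      have h2 := hsub (haS _ x.2)
      have hs0 := s.2.1
      have hs1 : 0 ≤ 1 - (s : ℝ) := sub_nonneg.2 s.2.2
      refine ⟨fun i => ⟨add_nonneg (mul_nonneg hs1 (h1.1 i).1) (mul_nonneg hs0 (h2.1 i).1), ?_⟩, ?_⟩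
      · have := mul_le_of_le_one_right hs1 (h1.1 i).2
        have := mul_le_of_le_one_right hs0 (h2.1 i).2
        linarith
      · rw [Finset.sum_add_distrib, ← Finset.mul_sum, ← Finset.mul_sum]
        have := le_mul_of_one_le_right hs1 h1.2
        have := le_mul_of_one_le_right hs0 h2.2
        linarith
    refine Collapse.map_homotopic _ _ ⟨fun z => ⟨_, hmem z.1 z.2⟩, ?_⟩ ?_ ?_ ?_
    · refine Continuous.subtype_mk (continuous_pi fun i => ?_) _
      have h1 : Continuous fun z : unitInterval × fatSimplexSystem.A n => z.2.1 i :=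
        (continuous_apply i).comp (continuous_subtype_val.comp continuous_snd)
      have h2 : Continuous fun z : unitInterval × fatSimplexSystem.A n => a z.2.1 :=
        hac.comp continuous_snd
      have h3 : Continuous fun z : unitInterval × fatSimplexSystem.A n => (z.1 : ℝ) :=
        continuous_subtype_val.comp continuous_fst
      exact ((continuous_const.sub h3).mul h1).add (h3.mul (h2.mul h1))
    · intro x
      ext i
      simp
    · intro x
      ext i
      simp [g, TupleSystem.Hom.tupleMap, hφ]
    · rintro s x ⟨i, hi⟩
      exact ⟨i, by simp [hi]⟩

theorem isEquivalence_simplexInclusion : simplexInclusion.operadHom.IsEquivalence := by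
  intro n
  have hpos : ∀ x ∈ fatSimplexSystem.A n, 0 < ∑ i, x i := fun x hx => one_pos.trans_le hx.2
  refine isWeakHomotopyEquiv_of_rescale simplexInclusion rfl (fun _ h => h)
    (fun x => (∑ i, x i)⁻¹) ?_ ?_ ?_
  · exact ContinuousOn.inv₀ (by fun_prop) fun x hx => (hpos x hx).ne'
  · intro x hx
    refine ⟨fun i => mul_nonneg (inv_nonneg.2 (hpos x hx).le) (hx.1 i).1, ?_⟩
    rw [← Finset.mul_sum, inv_mul_cancel₀ (hpos x hx).ne']
  · intro x hx
    rw [hx.2, inv_one]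

theorem isEquivalence_maxSimplexInclusion : maxSimplexInclusion.operadHom.IsEquivalence := by
  intro n
  let b : (Fin n → ℝ) → ℝ := fun x => Finset.univ.sup' Finset.univ_nonempty x
  have hb : ∀ x i, x i ≤ b x := fun x i => Finset.le_sup' x (Finset.mem_univ i)
  have hpos : ∀ x ∈ fatSimplexSystem.A n, 0 < b x := by
    intro x hx
    by_contra h
    have : ∑ i, x i ≤ 0 := Finset.sum_nonpos fun i _ => (hb x i).trans (not_lt.1 h)
    linarith [hx.2]
  refine isWeakHomotopyEquiv_of_rescale maxSimplexInclusion rfl (fun _ h => h)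
    (fun x => (b x)⁻¹) ?_ ?_ ?_
  · refine ContinuousOn.inv₀ (Continuous.continuousOn ?_) fun x hx => (hpos x hx).ne'
    exact Continuous.finset_sup'_apply _ fun i _ => continuous_apply i
  · intro x hx
    refine ⟨fun i => ⟨mul_nonneg (inv_nonneg.2 (hpos x hx).le) (hx.1 i).1,
      inv_mul_le_one_of_le₀ (hb x i) (hpos x hx).le⟩, ?_⟩
    obtain ⟨i, -, hi⟩ := Finset.exists_mem_eq_sup' Finset.univ_nonempty x
    refine ⟨i, ?_⟩
    change (b x)⁻¹ * x i = 1
    rw [← hi, inv_mul_cancel₀ (hpos x hx).ne']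
  · rintro x ⟨hx, i, hi⟩
    have : b x = 1 := le_antisymm (Finset.sup'_le _ _ fun j _ => (hx j).2) (hi ▸ hb x i)
    rw [this, inv_one]

/-! ### Intervals in the half-line -/

/-- An interval `[a, a + len]` in `[0, ∞]`, where `a = ∞` is allowed, recorded by its length and by
`pos = exp (-a)`. -/
@[ext]
structure ExpInterval where
  pos : ℝ
  len : ℝ
  pos_nonneg : 0 ≤ pos
  pos_le_one : pos ≤ 1
  len_pos : 0 < len

namespace ExpInterval

/-- The product of `[a, a + l]` and `[b, b + m]` is the image of the latter under the affine map
`x ↦ a + l x`. -/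
noncomputable instance : Monoid ExpInterval where
  one := ⟨1, 1, zero_le_one, le_rfl, one_pos⟩
  mul x y :=
    -- This is exp(-(a + l b)) = exp(-a) (exp(-b))^l. As l > 0, the value 0 of either position is
    -- absorbing, as the point ∞ should be.
    { pos := x.pos * y.pos ^ x.len
      len := x.len * y.len
      pos_nonneg := mul_nonneg x.pos_nonneg (Real.rpow_nonneg y.pos_nonneg _)
      pos_le_one := mul_le_one₀ x.pos_le_one (Real.rpow_nonneg y.pos_nonneg _)
        (Real.rpow_le_one y.pos_nonneg y.pos_le_one x.len_pos.le)
      len_pos := mul_pos x.len_pos y.len_pos }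
  mul_assoc x y z := by
    ext
    · change (x.pos * y.pos ^ x.len) * z.pos ^ (x.len * y.len) =
        x.pos * (y.pos * z.pos ^ y.len) ^ x.len
      rw [Real.mul_rpow y.pos_nonneg (Real.rpow_nonneg z.pos_nonneg _),
        ← Real.rpow_mul z.pos_nonneg, mul_comm y.len, mul_assoc]
    · exact mul_assoc _ _ _
  one_mul x := by
    ext
    · change 1 * x.pos ^ (1 : ℝ) = x.pos
      rw [Real.rpow_one, one_mul]
    · exact one_mul _
  mul_one x := by
    ext
    · change x.pos * 1 ^ x.len = x.pos
      rw [Real.one_rpow, mul_one]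
    · exact mul_one _

theorem mul_pos_eq (x y : ExpInterval) : (x * y).pos = x.pos * y.pos ^ x.len := rfl

theorem mul_len_eq (x y : ExpInterval) : (x * y).len = x.len * y.len := rfl

/-- The two parameters of an interval. -/
def params (x : ExpInterval) : ℝ × ℝ := (x.pos, x.len)

/-- The topology is induced from `ℝ²`. -/
instance : TopologicalSpace ExpInterval := TopologicalSpace.induced params inferInstance

theorem isInducing_params : Topology.IsInducing params := ⟨rfl⟩

theorem isEmbedding_params : Topology.IsEmbedding params :=
  ⟨isInducing_params, fun _ _ h => ExpInterval.ext (congrArg Prod.fst h) (congrArg Prod.snd h)⟩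

theorem range_params :
    Set.range params = {p : ℝ × ℝ | 0 < p.2} ∩ {p | 0 ≤ p.1 ∧ p.1 ≤ 1} := by
  ext p
  constructor
  · rintro ⟨x, rfl⟩
    exact ⟨x.len_pos, x.pos_nonneg, x.pos_le_one⟩
  · rintro ⟨h1, h2, h3⟩
    exact ⟨⟨p.1, p.2, h2, h3, h1⟩, rfl⟩

theorem continuous_pos : Continuous pos := continuous_fst.comp isInducing_params.continuous

theorem continuous_len : Continuous len := continuous_snd.comp isInducing_params.continuous

theorem continuous_iff {Z : Type} [TopologicalSpace Z] {f : Z → ExpInterval} :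
    Continuous f ↔ Continuous (fun z => (f z).pos) ∧ Continuous fun z => (f z).len := by
  rw [isInducing_params.continuous_iff, continuous_prodMk.symm]
  rfl

instance : T3Space ExpInterval := isEmbedding_params.t3Space

instance : LocallyCompactSpace ExpInterval := by
  refine isInducing_params.locallyCompactSpace ⟨_, _, ?_, ?_, range_params⟩
  · exact isOpen_lt continuous_const continuous_snd
  · exact (isClosed_le continuous_const continuous_fst).inter
      (isClosed_le continuous_fst continuous_const)

instance : ContinuousMul ExpInterval where
  continuous_mul := by
    have h1 : Continuous fun p : ExpInterval × ExpInterval => p.1.pos :=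
      continuous_pos.comp continuous_fst
    have h2 : Continuous fun p : ExpInterval × ExpInterval => p.1.len :=
      continuous_len.comp continuous_fst
    have h3 : Continuous fun p : ExpInterval × ExpInterval => p.2.pos :=
      continuous_pos.comp continuous_snd
    have h4 : Continuous fun p : ExpInterval × ExpInterval => p.2.len :=
      continuous_len.comp continuous_snd
    -- The base of the power may vanish; continuity there comes from the positive exponent.
    exact continuous_iff.2 ⟨h1.mul (h3.rpow h2 fun p => Or.inr p.1.len_pos), h2.mul h4⟩

/-- The number `exp (-b)`, where `b` is the right end point of the interval. -/
noncomputable def rightPos (x : ExpInterval) : ℝ := x.pos * Real.exp (-x.len)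

theorem continuous_rightPos : Continuous rightPos :=
  continuous_pos.mul (Real.continuous_exp.comp continuous_len.neg)

theorem rightPos_nonneg (x : ExpInterval) : 0 ≤ x.rightPos :=
  mul_nonneg x.pos_nonneg (Real.exp_pos _).le

/-- The affine map x ↦ a + l x acts on right ends by the same formula as on left ends. -/
theorem rightPos_mul (x y : ExpInterval) :
    (x * y).rightPos = x.pos * y.rightPos ^ x.len := by
  unfold rightPos
  rw [mul_pos_eq, mul_len_eq, Real.mul_rpow y.pos_nonneg (Real.exp_pos _).le, ← Real.exp_mul,
    mul_assoc]
  congr 4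
  ring

/-- An interval in `[0, 1]` is carried into `x` by the affine map, so its image ends no later than
`x` does. -/
theorem rightPos_le_rightPos_mul {x y : ExpInterval} (hy : Real.exp (-1) ≤ y.rightPos) :
    x.rightPos ≤ (x * y).rightPos := by
  rw [rightPos_mul, rightPos]
  refine mul_le_mul_of_nonneg_left ?_ x.pos_nonneg
  refine le_trans (le_of_eq ?_) (Real.rpow_le_rpow (Real.exp_pos _).le hy x.len_pos.le)
  rw [← Real.exp_mul]
  congr 1
  ring

theorem mul_pos_le (x y : ExpInterval) : (x * y).pos ≤ x.pos :=
  mul_le_of_le_one_right x.pos_nonneg (Real.rpow_le_one y.pos_nonneg y.pos_le_one x.len_pos.le)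

end ExpInterval

/-- The tuples of intervals in the half-line such that some interval lies in `[0, 1]`, modulo the
tuples in which two intervals do not overlap. -/
noncomputable def expSystem : TupleSystem ExpInterval where
  A n := {x | ∃ i, Real.exp (-1) ≤ (x i).rightPos}
  -- The case i = j is allowed: since lengths are positive, it says that the `i`-th position
  -- parameter is 0, i.e. the interval is at infinity.
  B n := {x | ∃ i j, (x j).pos ≤ (x i).rightPos}
  isClosed_A n := by
    simp only [Set.ofPred_exists]
    exact isClosed_iUnion_of_finite fun i => isClosed_le continuous_const
      (ExpInterval.continuous_rightPos.comp (continuous_apply i))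
  isClosed_B n := by
    simp only [Set.ofPred_exists]
    exact isClosed_iUnion_of_finite fun i => isClosed_iUnion_of_finite fun j => isClosed_le
      (ExpInterval.continuous_pos.comp (continuous_apply j))
      (ExpInterval.continuous_rightPos.comp (continuous_apply i))
  perm_A := by
    rintro n x σ ⟨i, hi⟩
    exact ⟨σ.symm i, by simpa using hi⟩
  perm_B := by
    rintro n x σ ⟨i, j, hi⟩
    exact ⟨σ.symm i, σ.symm j, by simpa using hi⟩
  one_A := ⟨0, (one_mul _).ge⟩
  mul_A := by
    rintro k n c d ⟨s, hs⟩ hd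
    obtain ⟨r, hr⟩ := hd s
    refine ⟨blockEquiv n ⟨s, r⟩, ?_⟩
    rw [blockMul_blockEquiv]
    exact hs.trans (ExpInterval.rightPos_le_rightPos_mul hr)
  mul_B_left := by
    rintro k n c d - hd ⟨i, j, hij⟩
    -- Here the condition defining `A` is essential: some interval of `d i` lies in `[0, 1]`, so its
    -- image ends no later than `c i`, while every image under `c j` starts no earlier than `c j`.
    obtain ⟨r, hr⟩ := hd i
    refine ⟨blockEquiv n ⟨i, r⟩, blockEquiv n ⟨j, 0⟩, ?_⟩
    rw [blockMul_blockEquiv, blockMul_blockEquiv]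
    exact ((c j).mul_pos_le _).trans (hij.trans (ExpInterval.rightPos_le_rightPos_mul hr))
  mul_B_right := by
    rintro k n c d s - - ⟨i, j, hij⟩
    refine ⟨blockEquiv n ⟨s, i⟩, blockEquiv n ⟨s, j⟩, ?_⟩
    rw [blockMul_blockEquiv, blockMul_blockEquiv, ExpInterval.rightPos_mul,
      ExpInterval.mul_pos_eq]
    exact mul_le_mul_of_nonneg_left (Real.rpow_le_rpow (d s j).pos_nonneg hij (c s).len_pos.le)
      (c s).pos_nonneg

/-- A subinterval of `[0, 1]` as an interval in the half-line. -/
noncomputable def Subinterval.toExp (J : Subinterval) : ExpInterval where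
  pos := Real.exp (-J.lo)
  len := J.hi - J.lo
  pos_nonneg := (Real.exp_pos _).le
  pos_le_one := Real.exp_le_one_iff.2 (neg_nonpos.2 J.zero_le)
  len_pos := sub_pos.2 J.lt

theorem Subinterval.rightPos_toExp (J : Subinterval) : J.toExp.rightPos = Real.exp (-J.hi) := by
  change Real.exp (-J.lo) * Real.exp (-(J.hi - J.lo)) = _
  rw [← Real.exp_add]
  congr 1
  ring

theorem Subinterval.continuous_toExp : Continuous Subinterval.toExp :=
  ExpInterval.continuous_iff.2 ⟨Real.continuous_exp.comp continuous_lo.neg,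
    continuous_hi.sub continuous_lo⟩

/-- One-dimensional Helly: if every left end is smaller than every right end, a point between the
largest left end and the smallest right end is interior to all intervals. -/
theorem mem_intervalSystem_B_iff {n : ℕ+} (x : Fin n → Subinterval) :
    x ∈ intervalSystem.B n ↔ ∃ i j, (x i).hi ≤ (x j).lo := by
  change interior (⋂ i, (x i).toSet) = ∅ ↔ _
  rw [Subinterval.interior_iInter_eq_empty_iff]
  constructor
  · intro h
    by_contra! h'
    obtain ⟨j, -, hj⟩ := Finset.exists_mem_eq_sup' Finset.univ_nonempty fun i => (x i).lo
    obtain ⟨i, -, hi⟩ := Finset.exists_mem_eq_inf' Finset.univ_nonempty fun i => (x i).hi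
    obtain ⟨u, hu1, hu2⟩ := exists_between (h' i j)
    refine h ⟨u, fun k => ⟨lt_of_le_of_lt ?_ hu1, lt_of_lt_of_le hu2 ?_⟩⟩
    · rw [← hj]
      exact Finset.le_sup' (fun i => (x i).lo) (Finset.mem_univ k)
    · rw [← hi]
      exact Finset.inf'_le (fun i => (x i).hi) (Finset.mem_univ k)
  · rintro ⟨i, j, hij⟩ ⟨u, hu⟩
    exact (((hu j).1.trans (hu i).2).trans_le hij).false

/-- The inclusion of the intervals in `[0, 1]`. -/
noncomputable def intervalInclusion : TupleSystem.Hom intervalSystem expSystem where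
  toFun := Subinterval.toExp
  domain := Set.univ
  mem_domain _ _ := trivial
  continuousOn := Subinterval.continuous_toExp.continuousOn
  map_one := by
    ext
    · change Real.exp (-0) = 1
      simp
    · exact sub_zero 1
  map_mul := by
    intro x y _ _
    ext
    · change Real.exp (-(x.lo + (x.hi - x.lo) * y.lo)) =
        Real.exp (-x.lo) * Real.exp (-y.lo) ^ (x.hi - x.lo)
      rw [← Real.exp_mul, ← Real.exp_add]
      congr 1
      ring
    · change x.param y.hi - x.param y.lo = (x.hi - x.lo) * (y.hi - y.lo)
      unfold Subinterval.param
      ring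
  map_A := by
    intro n x _
    refine ⟨0, ?_⟩
    rw [Function.comp_apply, Subinterval.rightPos_toExp]
    exact Real.exp_le_exp.2 (neg_le_neg (x 0).le_one)
  map_B := by
    intro n x _ hx
    obtain ⟨i, j, hij⟩ := (mem_intervalSystem_B_iff x).1 hx
    refine ⟨i, j, ?_⟩
    rw [Function.comp_apply, Function.comp_apply, Subinterval.rightPos_toExp]
    exact Real.exp_le_exp.2 (neg_le_neg hij)

/-- The interval `[a, a + 1]` with `t = exp (-a)`. -/
noncomputable def unitExpInterval (t : ℝ) : ExpInterval where
  -- Clamping makes the function total and continuous on ℝ; it is the identity on [0, 1].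
  pos := max 0 (min t 1)
  len := 1
  pos_nonneg := le_max_left _ _
  pos_le_one := max_le zero_le_one (min_le_right _ _)
  len_pos := one_pos

theorem unitExpInterval_pos {t : ℝ} (h0 : 0 ≤ t) (h1 : t ≤ 1) : (unitExpInterval t).pos = t := by
  change max 0 (min t 1) = t
  rw [min_eq_left h1, max_eq_right h0]

theorem continuous_unitExpInterval : Continuous unitExpInterval :=
  ExpInterval.continuous_iff.2
    ⟨continuous_const.max (continuous_id.min continuous_const), continuous_const⟩

/-- Coordinates with maximum `1` as intervals of unit length. -/
noncomputable def maxSimplexToExp : TupleSystem.Hom maxSimplexSystem expSystem where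
  toFun := unitExpInterval
  domain := Set.Icc 0 1
  mem_domain hx i := hx.1 i
  continuousOn := continuous_unitExpInterval.continuousOn
  map_one := by
    ext
    · exact unitExpInterval_pos zero_le_one le_rfl
    · rfl
  map_mul := by
    intro x y hx hy
    ext
    · rw [unitExpInterval_pos (mul_nonneg hx.1 hy.1) (mul_le_one₀ hx.2 hy.1 hy.2),
        ExpInterval.mul_pos_eq, unitExpInterval_pos hx.1 hx.2, unitExpInterval_pos hy.1 hy.2]
      exact congrArg (x * ·) (Real.rpow_one y).symm
    · exact (one_mul 1).symm
  map_A := by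
    rintro n x ⟨-, i, hi⟩
    refine ⟨i, ?_⟩
    rw [Function.comp_apply, hi, ExpInterval.rightPos, unitExpInterval_pos zero_le_one le_rfl,
      one_mul]
    exact le_rfl
  map_B := by
    rintro n x - ⟨i, hi⟩
    -- A vanishing coordinate becomes an interval at infinity, which is degenerate by itself.
    refine ⟨i, i, ?_⟩
    rw [Function.comp_apply, hi, unitExpInterval_pos le_rfl zero_le_one]
    exact ExpInterval.rightPos_nonneg _

/-! ### Deformations of tuples of intervals in the half-line -/

namespace ExpInterval

variable {n : ℕ+}

/-- The minimal length in a tuple of intervals. -/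
noncomputable def minLen (x : Fin n → ExpInterval) : ℝ :=
  Finset.univ.inf' Finset.univ_nonempty fun i => (x i).len

/-- The maximal position parameter in a tuple of intervals; it belongs to the interval with the
smallest left end point. -/
noncomputable def maxPos (x : Fin n → ExpInterval) : ℝ :=
  Finset.univ.sup' Finset.univ_nonempty fun i => (x i).pos

/-- The position parameters relative to the smallest left end point, truncated at the minimal
length. -/
noncomputable def relPos (x : Fin n → ExpInterval) (i : Fin n) : ℝ :=
  max ((x i).pos / maxPos x) (Real.exp (-minLen x))

theorem minLen_le (x : Fin n → ExpInterval) (i : Fin n) : minLen x ≤ (x i).len :=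
  Finset.inf'_le _ (Finset.mem_univ i)

theorem pos_le_maxPos (x : Fin n → ExpInterval) (i : Fin n) : (x i).pos ≤ maxPos x :=
  Finset.le_sup' (fun i => (x i).pos) (Finset.mem_univ i)

theorem exists_pos_eq_maxPos (x : Fin n → ExpInterval) : ∃ i, (x i).pos = maxPos x := by
  obtain ⟨i, -, hi⟩ := Finset.exists_mem_eq_sup' Finset.univ_nonempty fun i => (x i).pos
  exact ⟨i, hi.symm⟩

theorem minLen_pos (x : Fin n → ExpInterval) : 0 < minLen x := by
  obtain ⟨i, -, hi⟩ := Finset.exists_mem_eq_inf' Finset.univ_nonempty fun i => (x i).len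
  exact (x i).len_pos.trans_eq hi.symm

theorem maxPos_le_one (x : Fin n → ExpInterval) : maxPos x ≤ 1 :=
  Finset.sup'_le _ _ fun i _ => (x i).pos_le_one

/-- The interval of the tuple that lies in `[0, 1]` has length at most 1. -/
theorem minLen_le_one {x : Fin n → ExpInterval} (hx : x ∈ expSystem.A n) : minLen x ≤ 1 := by
  obtain ⟨i, hi⟩ := hx
  have h := hi.trans (mul_le_of_le_one_left (Real.exp_pos _).le (x i).pos_le_one)
  exact (minLen_le x i).trans (neg_le_neg_iff.1 (Real.exp_le_exp.1 h))

/-- The interval of the tuple that lies in `[0, 1]` is not at infinity. -/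
theorem maxPos_pos {x : Fin n → ExpInterval} (hx : x ∈ expSystem.A n) : 0 < maxPos x := by
  obtain ⟨i, hi⟩ := hx
  refine lt_of_lt_of_le ?_ (pos_le_maxPos x i)
  exact pos_of_mul_pos_left ((Real.exp_pos _).trans_le hi) (Real.exp_pos _).le

theorem exp_le_relPos (x : Fin n → ExpInterval) (i : Fin n) :
    Real.exp (-minLen x) ≤ relPos x i := le_max_right _ _

theorem relPos_pos (x : Fin n → ExpInterval) (i : Fin n) : 0 < relPos x i :=
  (Real.exp_pos _).trans_le (exp_le_relPos x i)

theorem exp_neg_minLen_le_one (x : Fin n → ExpInterval) : Real.exp (-minLen x) ≤ 1 :=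
  Real.exp_le_one_iff.2 (neg_nonpos.2 (minLen_pos x).le)

theorem relPos_le_one {x : Fin n → ExpInterval} (hx : x ∈ expSystem.A n) (i : Fin n) :
    relPos x i ≤ 1 :=
  max_le (div_le_one_of_le₀ (pos_le_maxPos x i) (maxPos_pos hx).le) (exp_neg_minLen_le_one x)

theorem pos_le_relPos {x : Fin n → ExpInterval} (hx : x ∈ expSystem.A n) (i : Fin n) :
    (x i).pos ≤ relPos x i :=
  (le_div_self (x i).pos_nonneg (maxPos_pos hx) (maxPos_le_one x)).trans (le_max_left _ _)

theorem relPos_eq_one {x : Fin n → ExpInterval} (hx : x ∈ expSystem.A n) {k : Fin n}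
    (hk : (x k).pos = maxPos x) : relPos x k = 1 := by
  unfold relPos
  rw [hk, div_self (maxPos_pos hx).ne', max_eq_left (exp_neg_minLen_le_one x)]

/-- Let `k` be leftmost and let `j` start after `i` ends. With m the minimal length, a_j ≥ a_i + l_i
≥ a_k + m, so after translation and truncation `k` starts at 0 and `j` exactly at m. This pair
witnesses degeneracy throughout the later deformations. -/
theorem exists_relPos_eq_exp {x : Fin n → ExpInterval} (hx : x ∈ expSystem.A n)
    (hB : x ∈ expSystem.B n) :
    ∃ k j, relPos x k = 1 ∧ relPos x j = Real.exp (-minLen x) ∧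
      (x j).pos ≤ (x k).pos * Real.exp (-minLen x) := by
  obtain ⟨k, hk⟩ := exists_pos_eq_maxPos x
  obtain ⟨i, j, hij⟩ := hB
  have h : (x j).pos ≤ (x k).pos * Real.exp (-minLen x) := by
    refine hij.trans (mul_le_mul (hk ▸ pos_le_maxPos x i) ?_ (Real.exp_pos _).le (x k).pos_nonneg)
    exact Real.exp_le_exp.2 (neg_le_neg (minLen_le x i))
  refine ⟨k, j, relPos_eq_one hx hk, max_eq_right ?_, h⟩
  rw [div_le_iff₀ (maxPos_pos hx), mul_comm, ← hk]
  exact h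

theorem continuous_minLen : Continuous (minLen : (Fin n → ExpInterval) → ℝ) :=
  Continuous.finset_inf'_apply _ fun i _ => continuous_len.comp (continuous_apply i)

theorem continuous_maxPos : Continuous (maxPos : (Fin n → ExpInterval) → ℝ) :=
  Continuous.finset_sup'_apply _ fun i _ => continuous_pos.comp (continuous_apply i)

theorem continuous_relPos (i : Fin n) :
    Continuous fun x : expSystem.A n => relPos x.1 i := by
  refine Continuous.max (Continuous.div ?_ ?_ fun x => (maxPos_pos x.2).ne') ?_
  · exact continuous_pos.comp ((continuous_apply i).comp continuous_subtype_val)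
  · exact continuous_maxPos.comp continuous_subtype_val
  · exact Real.continuous_exp.comp (continuous_minLen.comp continuous_subtype_val).neg

/-- A family of tuples of intervals, given by its parameters. -/
def mkTuple {Z : Type} [TopologicalSpace Z] (u l : Z → Fin n → ℝ)
    (hu : ∀ i, Continuous fun z => u z i) (hl : ∀ i, Continuous fun z => l z i)
    (h0 : ∀ z i, 0 ≤ u z i) (h1 : ∀ z i, u z i ≤ 1) (hpos : ∀ z i, 0 < l z i)
    (hA : ∀ z, ∃ i, Real.exp (-1) ≤ u z i * Real.exp (-l z i)) : C(Z, expSystem.A n) where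
  toFun z := ⟨fun i => ⟨u z i, l z i, h0 z i, h1 z i, hpos z i⟩, hA z⟩
  continuous_toFun := Continuous.subtype_mk
    (continuous_pi fun i => continuous_iff.2 ⟨hu i, hl i⟩) _

section Deformations

open unitInterval

theorem continuous_pos_snd (i : Fin n) :
    Continuous fun z : I × expSystem.A n => (z.2.1 i).pos :=
  continuous_pos.comp ((continuous_apply i).comp (continuous_subtype_val.comp continuous_snd))

theorem continuous_len_snd (i : Fin n) :
    Continuous fun z : I × expSystem.A n => (z.2.1 i).len :=
  continuous_len.comp ((continuous_apply i).comp (continuous_subtype_val.comp continuous_snd))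

theorem continuous_minLen_snd : Continuous fun z : I × expSystem.A n => minLen z.2.1 :=
  continuous_minLen.comp (continuous_subtype_val.comp continuous_snd)

theorem continuous_relPos_snd (i : Fin n) :
    Continuous fun z : I × expSystem.A n => relPos z.2.1 i :=
  (continuous_relPos i).comp continuous_snd

theorem continuous_coe_fst : Continuous fun z : I × expSystem.A n => (z.1 : ℝ) :=
  continuous_subtype_val.comp continuous_fst

/-! ### Convex combinations of parameters. -/

/-- A convex combination of two real numbers. -/
def segment (s : I) (a b : ℝ) : ℝ := (1 - (s : ℝ)) * a + s * b

theorem segment_zero (a b : ℝ) : segment 0 a b = a := by simp [segment]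

theorem segment_one (a b : ℝ) : segment 1 a b = b := by simp [segment]

theorem segment_self (s : I) (a : ℝ) : segment s a a = a := by
  unfold segment
  ring

theorem segment_mono (s : I) {a b a' b' : ℝ} (ha : a ≤ a') (hb : b ≤ b') :
    segment s a b ≤ segment s a' b' :=
  add_le_add (mul_le_mul_of_nonneg_left ha (sub_nonneg.2 s.2.2))
    (mul_le_mul_of_nonneg_left hb s.2.1)

theorem segment_mul (s : I) (a b c : ℝ) : segment s a b * c = segment s (a * c) (b * c) := by
  unfold segment
  ring

theorem le_segment (s : I) {a b c : ℝ} (ha : c ≤ a) (hb : c ≤ b) : c ≤ segment s a b :=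
  (segment_self s c).ge.trans (segment_mono s ha hb)

theorem segment_le (s : I) {a b c : ℝ} (ha : a ≤ c) (hb : b ≤ c) : segment s a b ≤ c :=
  (segment_mono s ha hb).trans (segment_self s c).le

theorem continuous_segment {Z : Type} [TopologicalSpace Z] {s : Z → I} {a b : Z → ℝ}
    (hs : Continuous s) (ha : Continuous a) (hb : Continuous b) :
    Continuous fun z => segment (s z) (a z) (b z) := by
  have h := continuous_subtype_val.comp hs
  exact ((continuous_const.sub h).mul ha).add (h.mul hb)

/-- Moving the left end to the left and shortening the interval both move the right end to the left.
With c = exp(-1) this keeps intervals in `[0, 1]`; with c the position of another interval it keeps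
the two disjoint up to end points. -/
theorem le_mul_exp_of_le {c u u' l l' : ℝ} (h : c ≤ u * Real.exp (-l)) (hu : u ≤ u')
    (hu0 : 0 ≤ u) (hl : l' ≤ l) : c ≤ u' * Real.exp (-l') :=
  h.trans (mul_le_mul hu (Real.exp_le_exp.2 (neg_le_neg hl)) (Real.exp_pos _).le (hu0.trans hu))

/-! ### The deformations. -/

variable (n)

/-- Shrink all intervals to the minimal length, keeping the left end points. -/
noncomputable def shrinkLen : C(I × expSystem.A n, expSystem.A n) :=
  mkTuple (fun z i => (z.2.1 i).pos) (fun z i => segment z.1 (z.2.1 i).len (minLen z.2.1))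
    continuous_pos_snd
    (fun i => continuous_segment continuous_fst (continuous_len_snd i) continuous_minLen_snd)
    (fun z i => (z.2.1 i).pos_nonneg) (fun z i => (z.2.1 i).pos_le_one)
    (fun z i => (minLen_pos z.2.1).trans_le (le_segment _ (minLen_le z.2.1 i) le_rfl))
    (fun z => by
      obtain ⟨i, hi⟩ := z.2.2
      exact ⟨i, le_mul_exp_of_le hi le_rfl (z.2.1 i).pos_nonneg
        (segment_le _ le_rfl (minLen_le z.2.1 i))⟩)

/-- With all lengths minimal, translate the smallest left end point to `0`, and truncate the left
end points at the minimal length. -/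
noncomputable def moveLeft : C(I × expSystem.A n, expSystem.A n) :=
  mkTuple (fun z i => segment z.1 (z.2.1 i).pos (relPos z.2.1 i)) (fun z _ => minLen z.2.1)
    (fun i => continuous_segment continuous_fst (continuous_pos_snd i) (continuous_relPos_snd i))
    (fun _ => continuous_minLen_snd)
    (fun z i => le_segment _ (z.2.1 i).pos_nonneg (relPos_pos z.2.1 i).le)
    (fun z i => segment_le _ (z.2.1 i).pos_le_one (relPos_le_one z.2.2 i))
    (fun z _ => minLen_pos z.2.1)
    (fun z => by
      obtain ⟨i, hi⟩ := z.2.2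
      exact ⟨i, le_mul_exp_of_le hi (le_segment _ le_rfl (pos_le_relPos z.2.2 i))
        (z.2.1 i).pos_nonneg (minLen_le z.2.1 i)⟩)

theorem one_sub_half_pos (s : I) : 0 < 1 - (s : ℝ) / 2 := by linarith [s.2.2]

theorem one_sub_half_le_one (s : I) : 1 - (s : ℝ) / 2 ≤ 1 := by linarith [s.2.1]

/-- Shrink the truncated tuple by the factor `1 / 2`. -/
noncomputable def halve : C(I × expSystem.A n, expSystem.A n) :=
  mkTuple (fun z i => relPos z.2.1 i ^ (1 - (z.1 : ℝ) / 2))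
    (fun z _ => minLen z.2.1 * (1 - (z.1 : ℝ) / 2))
    (fun i => (continuous_relPos_snd i).rpow
      (continuous_const.sub (continuous_coe_fst.div_const 2)) fun z => Or.inl (relPos_pos _ i).ne')
    (fun _ => continuous_minLen_snd.mul (continuous_const.sub (continuous_coe_fst.div_const 2)))
    (fun z i => Real.rpow_nonneg (relPos_pos _ i).le _)
    (fun z i => Real.rpow_le_one (relPos_pos _ i).le (relPos_le_one z.2.2 i)
      (one_sub_half_pos z.1).le)
    (fun z _ => mul_pos (minLen_pos _) (one_sub_half_pos z.1))
    (fun z => by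
      -- The leftmost interval now starts at 0 and has length at most 1, so it is the one lying in
      -- `[0, 1]`.
      obtain ⟨k, hk⟩ := exists_pos_eq_maxPos z.2.1
      refine ⟨k, ?_⟩
      rw [relPos_eq_one z.2.2 hk, Real.one_rpow, one_mul]
      exact Real.exp_le_exp.2 (neg_le_neg (mul_le_one₀ (minLen_le_one z.2.2)
        (one_sub_half_pos z.1).le (one_sub_half_le_one z.1))))

/-- The barycentric parameters of a tuple of intervals, with maximum `1`. -/
noncomputable def bary {n : ℕ+} (x : Fin n → ExpInterval) (i : Fin n) : ℝ :=
  1 + Real.log (relPos x i) / minLen x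

theorem bary_nonneg {n : ℕ+} (x : Fin n → ExpInterval) (i : Fin n) : 0 ≤ bary x i := by
  have h : -minLen x ≤ Real.log (relPos x i) :=
    (Real.le_log_iff_exp_le (relPos_pos x i)).2 (exp_le_relPos x i)
  have h2 : -1 ≤ Real.log (relPos x i) / minLen x := by
    rw [le_div_iff₀ (minLen_pos x)]
    linarith
  unfold bary
  linarith

theorem bary_le_one {n : ℕ+} {x : Fin n → ExpInterval} (hx : x ∈ expSystem.A n) (i : Fin n) :
    bary x i ≤ 1 := by
  have h := div_nonpos_of_nonpos_of_nonneg
    (Real.log_nonpos (relPos_pos x i).le (relPos_le_one hx i)) (minLen_pos x).le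
  unfold bary
  linarith

theorem bary_eq_one {n : ℕ+} {x : Fin n → ExpInterval} {i : Fin n} (h : relPos x i = 1) :
    bary x i = 1 := by
  simp [bary, h]

theorem bary_eq_zero {n : ℕ+} {x : Fin n → ExpInterval} {i : Fin n}
    (h : relPos x i = Real.exp (-minLen x)) : bary x i = 0 := by
  unfold bary
  rw [h, Real.log_exp, neg_div, div_self (minLen_pos x).ne']
  norm_num

theorem continuous_bary {n : ℕ+} (i : Fin n) :
    Continuous fun x : expSystem.A n => bary x.1 i :=
  continuous_const.add (Continuous.div
    ((continuous_relPos i).log fun _ => (relPos_pos _ i).ne')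
    (continuous_minLen.comp continuous_subtype_val) fun _ => (minLen_pos _).ne')

/-- Move the truncated tuple to the intervals of length `1` given by its barycentric parameters. -/
noncomputable def toBary : C(I × expSystem.A n, expSystem.A n) :=
  mkTuple (fun z i => segment z.1 (relPos z.2.1 i) (bary z.2.1 i))
    (fun z _ => segment z.1 (minLen z.2.1) 1)
    (fun i => continuous_segment continuous_fst (continuous_relPos_snd i)
      ((continuous_bary i).comp continuous_snd))
    (fun _ => continuous_segment continuous_fst continuous_minLen_snd continuous_const)
    (fun z i => le_segment _ (relPos_pos _ i).le (bary_nonneg _ i))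
    (fun z i => segment_le _ (relPos_le_one z.2.2 i) (bary_le_one z.2.2 i))
    (fun z _ => (minLen_pos z.2.1).trans_le (le_segment _ le_rfl (minLen_le_one z.2.2)))
    (fun z => by
      obtain ⟨k, hk⟩ := exists_pos_eq_maxPos z.2.1
      have h := relPos_eq_one z.2.2 hk
      refine ⟨k, ?_⟩
      rw [h, bary_eq_one h, segment_self, one_mul]
      exact Real.exp_le_exp.2 (neg_le_neg (segment_le _ (minLen_le_one z.2.2) le_rfl)))

variable {n}

/-! ### Degenerate tuples remain degenerate. -/

theorem shrinkLen_mem_base (s : I) {x : expSystem.A n} (hx : x ∈ expSystem.base n) :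
    shrinkLen n (s, x) ∈ expSystem.base n := by
  obtain ⟨i, j, hij⟩ := hx
  exact ⟨i, j, le_mul_exp_of_le hij le_rfl (x.1 i).pos_nonneg
    (segment_le _ le_rfl (minLen_le x.1 i))⟩

/-- The original witnesses may stop working after truncation, so the pair from
`exists_relPos_eq_exp` is used. Its inequality holds at both ends, and it is linear in the positions
because the length is fixed. -/
theorem moveLeft_mem_base (s : I) {x : expSystem.A n} (hx : x ∈ expSystem.base n) :
    moveLeft n (s, x) ∈ expSystem.base n := by
  obtain ⟨k, j, hk, hj, hkj⟩ := exists_relPos_eq_exp x.2 hx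
  refine ⟨k, j, ?_⟩
  change segment s (x.1 j).pos (relPos x.1 j) ≤
    segment s (x.1 k).pos (relPos x.1 k) * Real.exp (-minLen x.1)
  rw [segment_mul, hk, hj, one_mul]
  exact segment_mono s hkj le_rfl

/-- Taking powers scales left ends linearly, so starting points 0 and m with length m become 0 and
cm with length cm. -/
theorem halve_mem_base (s : I) {x : expSystem.A n} (hx : x ∈ expSystem.base n) :
    halve n (s, x) ∈ expSystem.base n := by
  obtain ⟨k, j, hk, hj, -⟩ := exists_relPos_eq_exp x.2 hx
  refine ⟨k, j, ?_⟩
  change relPos x.1 j ^ (1 - (s : ℝ) / 2) ≤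
    relPos x.1 k ^ (1 - (s : ℝ) / 2) * Real.exp (-(minLen x.1 * (1 - (s : ℝ) / 2)))
  rw [hk, hj, Real.one_rpow, one_mul, ← Real.exp_mul, neg_mul]

/-- The interval `k` keeps starting at 0, while the position of `j` decreases linearly from exp(-m)
to 0. This is fast enough for `j` to stay beyond the right end of `k`, whose length grows from m to
1. -/
theorem toBary_mem_base (s : I) {x : expSystem.A n} (hx : x ∈ expSystem.base n) :
    toBary n (s, x) ∈ expSystem.base n := by
  obtain ⟨k, j, hk, hj, -⟩ := exists_relPos_eq_exp x.2 hx
  refine ⟨k, j, ?_⟩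
  change segment s (relPos x.1 j) (bary x.1 j) ≤
    segment s (relPos x.1 k) (bary x.1 k) * Real.exp (-segment s (minLen x.1) 1)
  rw [bary_eq_one hk, bary_eq_zero hj, hk, hj, segment_self, one_mul]
  have h1 : -segment s (minLen x.1) 1 = -minLen x.1 + -(s * (1 - minLen x.1)) := by
    unfold segment
    ring
  -- From exp(u) ≥ 1 + u with u = -s(1 - m), dropping the nonnegative term s m.
  have h2 : 1 - (s : ℝ) ≤ Real.exp (-(s * (1 - minLen x.1))) := by
    have := Real.add_one_le_exp (-((s : ℝ) * (1 - minLen x.1)))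
    have := mul_nonneg s.2.1 (minLen_pos x.1).le
    linarith
  rw [h1, Real.exp_add, segment, mul_zero, add_zero, mul_comm]
  exact mul_le_mul_of_nonneg_left h2 (Real.exp_pos _).le

/-- All intervals of the tuple lie in `[0, 1]`. -/
def InUnit (x : Fin n → ExpInterval) : Prop := ∀ i, Real.exp (-1) ≤ (x i).rightPos

theorem inUnit_shrinkLen (s : I) {x : expSystem.A n} (hx : InUnit x.1) :
    InUnit (shrinkLen n (s, x)).1 := fun i =>
  le_mul_exp_of_le (hx i) le_rfl (x.1 i).pos_nonneg (segment_le _ le_rfl (minLen_le x.1 i))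

theorem inUnit_moveLeft (s : I) {x : expSystem.A n} (hx : InUnit x.1) :
    InUnit (moveLeft n (s, x)).1 := fun i =>
  le_mul_exp_of_le (hx i) (le_segment _ le_rfl (pos_le_relPos x.2 i)) (x.1 i).pos_nonneg
    (minLen_le x.1 i)

theorem rightPos_halve (s : I) (x : expSystem.A n) (i : Fin n) :
    ((halve n (s, x)).1 i).rightPos =
      (relPos x.1 i * Real.exp (-minLen x.1)) ^ (1 - (s : ℝ) / 2) := by
  change relPos x.1 i ^ (1 - (s : ℝ) / 2) * Real.exp (-(minLen x.1 * (1 - (s : ℝ) / 2))) = _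
  rw [Real.mul_rpow (relPos_pos _ i).le (Real.exp_pos _).le, ← Real.exp_mul, neg_mul]

theorem inUnit_halve (s : I) {x : expSystem.A n} (hx : InUnit x.1) :
    InUnit (halve n (s, x)).1 := by
  intro i
  have h : Real.exp (-1) ≤ relPos x.1 i * Real.exp (-minLen x.1) :=
    le_mul_exp_of_le (hx i) (pos_le_relPos x.2 i) (x.1 i).pos_nonneg (minLen_le x.1 i)
  rw [rightPos_halve]
  refine le_trans ?_ (Real.rpow_le_rpow (Real.exp_pos _).le h (one_sub_half_pos s).le)
  rw [← Real.exp_mul]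
  exact Real.exp_le_exp.2 (by linarith [one_sub_half_le_one s])

/-- After truncation each interval starts by m and has length m ≤ 1, so it lies in `[0, 2]` before
the halving. -/
theorem inUnit_halve_one (x : expSystem.A n) : InUnit (halve n (1, x)).1 := by
  intro i
  rw [rightPos_halve]
  have h : Real.exp (-2) ≤ relPos x.1 i * Real.exp (-minLen x.1) := by
    refine le_trans ?_ (mul_le_mul_of_nonneg_right (exp_le_relPos x.1 i) (Real.exp_pos _).le)
    rw [← Real.exp_add]
    exact Real.exp_le_exp.2 (by linarith [minLen_le_one x.2])
  refine le_trans (le_of_eq ?_) (Real.rpow_le_rpow (Real.exp_pos _).le h (one_sub_half_pos 1).le)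
  rw [← Real.exp_mul]
  congr 1
  norm_num

/-! ### The ends at which the deformations are joined. -/

theorem shrinkLen_zero (x : expSystem.A n) : shrinkLen n (0, x) = x := by
  refine Subtype.ext (funext fun i => ExpInterval.ext rfl ?_)
  exact segment_zero _ _

theorem shrinkLen_one (x : expSystem.A n) : shrinkLen n (1, x) = moveLeft n (0, x) :=
  Subtype.ext (funext fun _ => ExpInterval.ext (segment_zero _ _).symm (segment_one _ _))

theorem moveLeft_one (x : expSystem.A n) : moveLeft n (1, x) = halve n (0, x) := by
  refine Subtype.ext (funext fun i => ExpInterval.ext ?_ ?_)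
  · change segment 1 _ _ = relPos x.1 i ^ (1 - ((0 : I) : ℝ) / 2)
    simp [segment_one]
  · change minLen x.1 = minLen x.1 * (1 - ((0 : I) : ℝ) / 2)
    simp

theorem moveLeft_one_eq_toBary (x : expSystem.A n) : moveLeft n (1, x) = toBary n (0, x) :=
  Subtype.ext (funext fun _ => ExpInterval.ext
    ((segment_one _ _).trans (segment_zero _ _).symm) (segment_zero _ _).symm)

end Deformations

end ExpInterval

/-! ### The equivalences with the operad of intervals in the half-line -/

namespace ExpInterval

open unitInterval

variable {n : ℕ+}

/-- The homotopy through maps of pairs given by a deformation. -/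
theorem map_homotopic_of_deformation (H : C(I × expSystem.A n, expSystem.A n))
    (hH : ∀ s, ∀ x ∈ expSystem.base n, H (s, x) ∈ expSystem.base n)
    {f g : C(expSystem.A n, expSystem.A n)} (h0 : ∀ x, f x = H (0, x)) (h1 : ∀ x, g x = H (1, x)) :
    ∃ (hf : Set.MapsTo f (expSystem.base n) (expSystem.base n))
      (hg : Set.MapsTo g (expSystem.base n) (expSystem.base n)),
      (Collapse.map f hf).Homotopic (Collapse.map g hg) :=
  ⟨fun x hx => by rw [h0]; exact hH 0 x hx, fun x hx => by rw [h1]; exact hH 1 x hx,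
    Collapse.map_homotopic _ _ H (fun x => (h0 x).symm) (fun x => (h1 x).symm) hH⟩

/-- The map at the end of a deformation. -/
def endMap (H : C(I × expSystem.A n, expSystem.A n)) : C(expSystem.A n, expSystem.A n) :=
  ⟨fun x => H (1, x), by fun_prop⟩

/-- Shrinking followed by truncation; its end is the common start of `halve` and `toBary`. The
homotopies are concatenated on the quotients. -/
theorem truncate_homotopic : ∃ hg : Set.MapsTo (endMap (moveLeft n)) (expSystem.base n)
    (expSystem.base n), (Collapse.map (ContinuousMap.id _) (Set.mapsTo_id _)).Homotopic
      (Collapse.map (endMap (moveLeft n)) hg) := by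
  obtain ⟨_, _, h1⟩ := map_homotopic_of_deformation (shrinkLen n)
    (fun s _ hx => shrinkLen_mem_base s hx) (f := ContinuousMap.id _)
    (g := endMap (shrinkLen n)) (fun x => (shrinkLen_zero x).symm) fun x => rfl
  obtain ⟨_, _, h2⟩ := map_homotopic_of_deformation (moveLeft n)
    (fun s _ hx => moveLeft_mem_base s hx) (f := endMap (shrinkLen n))
    (g := endMap (moveLeft n)) shrinkLen_one fun x => rfl
  exact ⟨_, h1.trans h2⟩

theorem halve_homotopic : ∃ hg : Set.MapsTo (endMap (halve n)) (expSystem.base n)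
    (expSystem.base n), (Collapse.map (ContinuousMap.id _) (Set.mapsTo_id _)).Homotopic
      (Collapse.map (endMap (halve n)) hg) := by
  obtain ⟨_, h1⟩ := truncate_homotopic (n := n)
  obtain ⟨_, _, h2⟩ := map_homotopic_of_deformation (halve n)
    (fun s _ hx => halve_mem_base s hx) (f := endMap (moveLeft n))
    (g := endMap (halve n)) moveLeft_one fun x => rfl
  exact ⟨_, h1.trans h2⟩

theorem toBary_homotopic : ∃ hg : Set.MapsTo (endMap (toBary n)) (expSystem.base n)
    (expSystem.base n), (Collapse.map (ContinuousMap.id _) (Set.mapsTo_id _)).Homotopic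
      (Collapse.map (endMap (toBary n)) hg) := by
  obtain ⟨_, h1⟩ := truncate_homotopic (n := n)
  obtain ⟨_, _, h2⟩ := map_homotopic_of_deformation (toBary n)
    (fun s _ hx => toBary_mem_base s hx) (f := endMap (moveLeft n))
    (g := endMap (toBary n)) moveLeft_one_eq_toBary fun x => rfl
  exact ⟨_, h1.trans h2⟩

/-! #### Intervals in `[0, 1]` -/

theorem pos_pos_of_le_rightPos {x : ExpInterval} (hx : Real.exp (-1) ≤ x.rightPos) : 0 < x.pos :=
  pos_of_mul_pos_left ((Real.exp_pos _).trans_le hx) (Real.exp_pos _).le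

/-- An interval in the half-line that is contained in `[0, 1]`, as a subinterval of `[0, 1]`. -/
noncomputable def toSubinterval (x : ExpInterval) (hx : Real.exp (-1) ≤ x.rightPos) :
    Subinterval where
  lo := -Real.log x.pos
  hi := -Real.log x.pos + x.len
  zero_le := neg_nonneg.2 (Real.log_nonpos x.pos_nonneg x.pos_le_one)
  lt := lt_add_of_pos_right _ x.len_pos
  le_one := by
    have h := (Real.le_log_iff_exp_le ((Real.exp_pos _).trans_le hx)).2 hx
    rw [rightPos, Real.log_mul (pos_pos_of_le_rightPos hx).ne' (Real.exp_pos _).ne',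
      Real.log_exp] at h
    linarith

theorem toExp_toSubinterval (x : ExpInterval) (hx : Real.exp (-1) ≤ x.rightPos) :
    (x.toSubinterval hx).toExp = x := by
  ext
  · change Real.exp (- -Real.log x.pos) = x.pos
    rw [neg_neg, Real.exp_log (pos_pos_of_le_rightPos hx)]
  · exact add_sub_cancel_left _ _

theorem toExp_injective : Function.Injective Subinterval.toExp := by
  intro J K h
  have h1 : J.lo = K.lo := neg_injective (Real.exp_injective (congrArg pos h))
  have h2 : J.hi - J.lo = K.hi - K.lo := congrArg len h
  exact Subinterval.ext h1 (by linarith)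

/-- A family of tuples of intervals in `[0, 1]`. -/
noncomputable def liftTuple {Z : Type} [TopologicalSpace Z] (f : C(Z, expSystem.A n))
    (hf : ∀ z, InUnit (f z).1) : C(Z, intervalSystem.A n) where
  toFun z := ⟨fun i => ((f z).1 i).toSubinterval (hf z i), trivial⟩
  continuous_toFun := by
    refine Continuous.subtype_mk (continuous_pi fun i => ?_) _
    have h : Continuous fun z => (f z).1 i :=
      (continuous_apply i).comp (continuous_subtype_val.comp f.continuous)
    have hlo := ((continuous_pos.comp h).log fun z =>
      (pos_pos_of_le_rightPos (hf z i)).ne').neg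
    exact Subinterval.isInducing_ends.continuous_iff.2
      (hlo.prodMk (hlo.add (continuous_len.comp h)))

theorem tupleMap_liftTuple {Z : Type} [TopologicalSpace Z] (f : C(Z, expSystem.A n))
    (hf : ∀ z, InUnit (f z).1) (z : Z) :
    intervalInclusion.tupleMap n (liftTuple f hf z) = f z :=
  Subtype.ext (funext fun i => toExp_toSubinterval _ (hf z i))

theorem tupleMap_injective : Function.Injective (intervalInclusion.tupleMap n) :=
  fun _ _ h => Subtype.ext (funext fun i =>
    toExp_injective (congrFun (congrArg Subtype.val h) i))

theorem inUnit_tupleMap (x : intervalSystem.A n) :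
    InUnit (intervalInclusion.tupleMap n x).1 := by
  intro i
  change _ ≤ (Subinterval.toExp (x.1 i)).rightPos
  rw [Subinterval.rightPos_toExp]
  exact Real.exp_le_exp.2 (neg_le_neg (x.1 i).le_one)

/-- Degeneracy in both systems means that some right end is at most some left end, so the base of Q
is the full preimage of that of E. -/
theorem mem_base_of_tupleMap_mem_base {x : intervalSystem.A n}
    (hx : intervalInclusion.tupleMap n x ∈ expSystem.base n) : x ∈ intervalSystem.base n := by
  obtain ⟨i, j, hij⟩ := hx
  refine (mem_intervalSystem_B_iff x.1).2 ⟨i, j, ?_⟩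
  change Real.exp (-(x.1 j).lo) ≤ (Subinterval.toExp (x.1 i)).rightPos at hij
  rw [Subinterval.rightPos_toExp] at hij
  exact neg_le_neg_iff.1 (Real.exp_le_exp.1 hij)

theorem mapsTo_of_tupleMap {f : C(intervalSystem.A n, intervalSystem.A n)}
    (h : ∀ x ∈ intervalSystem.base n, intervalInclusion.tupleMap n (f x) ∈ expSystem.base n) :
    Set.MapsTo f (intervalSystem.base n) (intervalSystem.base n) :=
  fun x hx => mem_base_of_tupleMap_mem_base (h x hx)

/-- A deformation that preserves the tuples with all intervals in `[0, 1]` restricts to Q. Since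
`tupleMap` is injective and reflects the base, all conditions can be checked in E. -/
theorem lift_homotopic_of_deformation (H : C(I × expSystem.A n, expSystem.A n))
    (hH : ∀ s, ∀ x ∈ expSystem.base n, H (s, x) ∈ expSystem.base n)
    (hU : ∀ s, ∀ x : expSystem.A n, InUnit x.1 → InUnit (H (s, x)).1)
    {f g : C(intervalSystem.A n, intervalSystem.A n)}
    (h0 : ∀ x, intervalInclusion.tupleMap n (f x) = H (0, intervalInclusion.tupleMap n x))
    (h1 : ∀ x, intervalInclusion.tupleMap n (g x) = H (1, intervalInclusion.tupleMap n x)) :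
    ∃ (hf : Set.MapsTo f (intervalSystem.base n) (intervalSystem.base n))
      (hg : Set.MapsTo g (intervalSystem.base n) (intervalSystem.base n)),
      (Collapse.map f hf).Homotopic (Collapse.map g hg) := by
  have hι := intervalInclusion.mapsTo_tupleMap n
  let K : C(I × intervalSystem.A n, intervalSystem.A n) :=
    liftTuple (H.comp ((ContinuousMap.id I).prodMap (intervalInclusion.tupleMap n)))
      fun z => hU _ _ (inUnit_tupleMap z.2)
  have hK : ∀ z, intervalInclusion.tupleMap n (K z) =
      H (z.1, intervalInclusion.tupleMap n z.2) := fun z => tupleMap_liftTuple _ _ z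
  refine ⟨mapsTo_of_tupleMap fun x hx => ?_, mapsTo_of_tupleMap fun x hx => ?_,
    Collapse.map_homotopic _ _ K (fun x => ?_) (fun x => ?_) fun s x hx => ?_⟩
  · rw [h0]
    exact hH 0 _ (hι hx)
  · rw [h1]
    exact hH 1 _ (hι hx)
  · exact tupleMap_injective ((hK _).trans (h0 x).symm)
  · exact tupleMap_injective ((hK _).trans (h1 x).symm)
  · refine mem_base_of_tupleMap_mem_base ?_
    rw [hK]
    exact hH s _ (hι hx)

end ExpInterval

-- The inverse is the end of `halve`, which lands in `[0, 1]`. One composite is homotopic to the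
-- identity by the chain shrink, truncate, halve on E; the other by the same chain restricted to Q,
-- where `f1` and `f2` are its intermediate stages.
open ExpInterval in
theorem isEquivalence_intervalInclusion : intervalInclusion.operadHom.IsEquivalence := by
  intro n
  let ι := intervalInclusion.tupleMap n
  let f1 : C(intervalSystem.A n, intervalSystem.A n) :=
    liftTuple ((endMap (shrinkLen n)).comp ι) fun x => inUnit_shrinkLen 1 (inUnit_tupleMap x)
  let f2 : C(intervalSystem.A n, intervalSystem.A n) :=
    liftTuple ((endMap (moveLeft n)).comp ι) fun x => inUnit_moveLeft 1 (inUnit_tupleMap x)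
  let g : C(expSystem.A n, intervalSystem.A n) := liftTuple (endMap (halve n)) inUnit_halve_one
  have e1 : ∀ x, ι (f1 x) = shrinkLen n (1, ι x) := tupleMap_liftTuple _ _
  have e2 : ∀ x, ι (f2 x) = moveLeft n (1, ι x) := tupleMap_liftTuple _ _
  have e3 : ∀ x, ι (g x) = halve n (1, x) := tupleMap_liftTuple _ _
  obtain ⟨_, _, h1⟩ := lift_homotopic_of_deformation (shrinkLen n)
    (fun s _ hx => shrinkLen_mem_base s hx) (fun s _ hx => inUnit_shrinkLen s hx)
    (f := ContinuousMap.id _) (fun x => (shrinkLen_zero (ι x)).symm) e1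
  obtain ⟨_, _, h2⟩ := lift_homotopic_of_deformation (moveLeft n)
    (fun s _ hx => moveLeft_mem_base s hx) (fun s _ hx => inUnit_moveLeft s hx)
    (f := f1) (fun x => (e1 x).trans (shrinkLen_one (ι x))) e2
  obtain ⟨_, _, h3⟩ := lift_homotopic_of_deformation (halve n)
    (fun s _ hx => halve_mem_base s hx) (fun s _ hx => inUnit_halve s hx)
    (f := f2) (g := g.comp ι) (fun x => (e2 x).trans (moveLeft_one (ι x))) fun x => e3 (ι x)
  have hg : Set.MapsTo g (expSystem.base n) (intervalSystem.base n) := by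
    refine fun x hx => mem_base_of_tupleMap_mem_base ?_
    change ι (g x) ∈ _
    rw [e3]
    exact halve_mem_base 1 hx
  refine Collapse.isWeakHomotopyEquiv_map ι (intervalInclusion.mapsTo_tupleMap n) g hg
    (h1.trans (h2.trans h3)) ?_
  obtain ⟨_, h4⟩ := halve_homotopic (n := n)
  have : ι.comp g = endMap (halve n) := ContinuousMap.ext e3
  simp only [this]
  exact h4

-- The inverse is `bary`. The composite on E is the end of `toBary`. The composite on M is t ↦ 1 +
-- log(max(t, exp(-1))) in each coordinate; it is not the identity, but it fixes 0 and 1, so the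
-- straight line to it keeps both the maximum 1 and every vanishing coordinate.
open ExpInterval in
theorem isEquivalence_maxSimplexToExp : maxSimplexToExp.operadHom.IsEquivalence := by
  intro n
  let ι := maxSimplexToExp.tupleMap n
  have hbary : ∀ x : expSystem.A n, ExpInterval.bary x.1 ∈ maxSimplexSystem.A n := by
    intro x
    obtain ⟨k, hk⟩ := exists_pos_eq_maxPos x.1
    exact ⟨fun i => ⟨bary_nonneg x.1 i, bary_le_one x.2 i⟩, k, bary_eq_one (relPos_eq_one x.2 hk)⟩
  let g : C(expSystem.A n, maxSimplexSystem.A n) :=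
    ⟨fun x => ⟨bary x.1, hbary x⟩, Continuous.subtype_mk (continuous_pi continuous_bary) _⟩
  have hg : Set.MapsTo g (expSystem.base n) (maxSimplexSystem.base n) := by
    intro x hx
    obtain ⟨k, j, -, hj, -⟩ := exists_relPos_eq_exp x.2 hx
    exact ⟨j, bary_eq_zero hj⟩
  have hι := maxSimplexToExp.mapsTo_tupleMap n
  refine Collapse.isWeakHomotopyEquiv_map ι hι g hg ?_ ?_
  · have hpos : ∀ (x : maxSimplexSystem.A n) i, ((ι x).1 i).pos = x.1 i := fun x i =>
      unitExpInterval_pos (x.2.1 i).1 (x.2.1 i).2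
    have hlen : ∀ x : maxSimplexSystem.A n, minLen (ι x).1 = 1 := fun x =>
      Finset.inf'_const _ 1
    have hone : ∀ (x : maxSimplexSystem.A n) k, x.1 k = 1 → bary (ι x).1 k = 1 := by
      intro x k hk
      refine bary_eq_one (relPos_eq_one (ι x).2 (le_antisymm (pos_le_maxPos _ k) ?_))
      rw [hpos, hk]
      exact maxPos_le_one _
    have hzero : ∀ (x : maxSimplexSystem.A n) k, x.1 k = 0 → bary (ι x).1 k = 0 := by
      intro x k hk
      refine bary_eq_zero (max_eq_right ?_)
      rw [hpos, hk, zero_div]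
      exact (Real.exp_pos _).le
    have hmem : ∀ z : unitInterval × maxSimplexSystem.A n,
        (fun i => segment z.1 (z.2.1 i) (bary (ι z.2).1 i)) ∈ maxSimplexSystem.A n := by
      rintro ⟨s, x⟩
      obtain ⟨k, hk⟩ := x.2.2
      refine ⟨fun i => ⟨le_segment s (x.2.1 i).1 (bary_nonneg _ i),
        segment_le s (x.2.1 i).2 (bary_le_one (ι x).2 i)⟩, k, ?_⟩
      change segment s (x.1 k) (bary (ι x).1 k) = 1
      rw [hone x k hk, hk, segment_self]
    refine Collapse.map_homotopic _ _ ⟨fun z => ⟨_, hmem z⟩, ?_⟩ ?_ ?_ ?_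
    · refine Continuous.subtype_mk (continuous_pi fun i => ?_) _
      refine continuous_segment (continuous_fst) ?_ ?_
      · exact (continuous_apply i).comp (continuous_subtype_val.comp continuous_snd)
      · exact (continuous_bary i).comp (ι.continuous.comp continuous_snd)
    · exact fun x => Subtype.ext (funext fun i => segment_zero _ _)
    · exact fun x => Subtype.ext (funext fun i => segment_one _ _)
    · rintro s x ⟨i, hi⟩
      refine ⟨i, ?_⟩
      change segment s (x.1 i) (bary (ι x).1 i) = 0
      rw [hzero x i hi, hi, segment_self]
  · obtain ⟨_, h⟩ := toBary_homotopic (n := n)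
    have : ι.comp g = endMap (toBary n) := by
      refine ContinuousMap.ext fun x => Subtype.ext (funext fun i => ExpInterval.ext ?_ ?_)
      · exact (unitExpInterval_pos (bary_nonneg _ i) (bary_le_one x.2 i)).trans
          (segment_one _ _).symm
      · exact (segment_one _ _).symm
    simp only [this]
    exact h

/-! ### The zigzag. -/

theorem mainTheorem12 : OneOperad.Equivalent intervalOperad simplexOperad := by
  have h1 : OneOperad.Equivalent intervalSystem.operad expSystem.operad :=
    .rel _ _ ⟨_, isEquivalence_intervalInclusion⟩
  have h2 : OneOperad.Equivalent maxSimplexSystem.operad expSystem.operad :=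
    .rel _ _ ⟨_, isEquivalence_maxSimplexToExp⟩
  have h3 : OneOperad.Equivalent maxSimplexSystem.operad fatSimplexSystem.operad :=
    .rel _ _ ⟨_, isEquivalence_maxSimplexInclusion⟩
  have h4 : OneOperad.Equivalent simplexSystem.operad fatSimplexSystem.operad :=
    .rel _ _ ⟨_, isEquivalence_simplexInclusion⟩
  exact ((h1.trans _ _ _ h2.symm).trans _ _ _ h3).trans _ _ _ h4.symm
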